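/- Let $F$ be a field of characteristic $0$, and let $n\ge 1$, $m\ge 0$, $b\ge 0$ be integers. Let $R(n,m)$ be the ring of polynomials $f$ on $m$-tuples of $n\times n$ matrices over $F$ with $f(AX_1C^{-1},\dots,AX_mC^{-1})=f(X_1,\dots,X_m)$ for all $A,C\in \mathrm{SL}(n,F)$. For $d\ge 1$ let $\mathcal P(d)$ be the span of the monomials $[i_{1,1},\dots,i_{1,n}]\circ\cdots\circ[i_{d,1},\dots,i_{d,n}]$ with $\{i_{j,k}\}=\{1,\dots,dn\}$ in the noncommutative polynomial ring over $F$ in the symbols $[i_1,\dots,i_n]$, $i_j\in\{1,\dots,dn\}$, subject to the relations that exchanging two entries of a symbol changes its sign; let $\overline{\mathcal P}(d)$ be a second copy of $\mathcal P(d)$. Put $V=W=F^n$, and let $\phi$ be the linear map from $\mathcal P(d)\otimes\overline{\mathcal P}(d)$ to the multilinear functions on $(V\otimes W)^{\oplus dn}$ that sends $S\otimes\overline T$ (with $S$, $\overline T$ monomials given by $d\times n$ tableaux $(i_{j,k})$, $(t_{j,k})$) to the multilinear function with $$(v_1\otimes w_1,\dots,v_{dn}\otimes w_{dn})\mapsto\prod_{j=1}^d\det[v_{i_{j,1}},\dots,v_{i_{j,n}}]\cdot\prod_{j=1}^d\det[w_{t_{j,1}},\dots,w_{t_{j,n}}].$$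 A correlated tableau is a $d\times d$ matrix $C$ of (possibly empty) subsets of $\{1,\dots,dn\}$ that partition $\{1,\dots,dn\}$, such that the union of the entries of each row and of each column has $n$ elements. It is identified with $S\otimes\overline T\in\mathcal P(d)\otimes\overline{\mathcal P}(d)$, where the $i$-th row of $S$ is the $i$-th row of $C$ read from left to right and the $j$-th row of $T$ is the $j$-th column of $C$ read from top to bottom, the elements of each entry being taken in increasing order. It is called disconnected if the bipartite graph with two sides $L=R=\{1,\dots,d\}$, and with $|C(i,j)|$ edges between $i\in L$ and $j\in R$, is disconnected. Let $\mathfrak D(d)$ be the span of the disconnected correlated tableaux in $\mathcal P(d)\otimes\overline{\mathcal P}(d)$. (i) If, for every $d>b$, the set $\mathfrak D(d)\cup\ker\phi$ spans $\mathcal P(d)\otimes\overline{\mathcal P}(d)$, then $R(n,m)$ is generated as an $F$-algebra by its elements of degree at most $bn$. (ii) If $m\ge n^2$, then $R(n,m)$ is generated as an $F$-algebra by its elements of degree at most $bn$ if and only if, for every $d>b$, $\mathfrak D(d)\cup\ker\phi$ spans $\mathcal P(d)\otimes\overline{\mathcal P}(d)$. -/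

import Mathlib

open scoped TensorProduct

/-! ### The ring of matrix semi-invariants -/

/-- The `k`-th `n × n` matrix of indeterminates `X_k = (x_{i,j}^{(k)})`. -/
noncomputable def genericMatrix (F : Type*) [Field F] (n m : ℕ) (k : Fin m) :
    Matrix (Fin n) (Fin n) (MvPolynomial (Fin m × Fin n × Fin n) F) :=
  Matrix.of fun i j => MvPolynomial.X (k, i, j)

/-- The algebra endomorphism `f(X_1, …, X_m) ↦ f(A X_1 B, …, A X_m B)`. -/
noncomputable def substMatrices {F : Type*} [Field F] {n : ℕ} (m : ℕ)
    (A B : Matrix (Fin n) (Fin n) F) :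
    MvPolynomial (Fin m × Fin n × Fin n) F →ₐ[F] MvPolynomial (Fin m × Fin n × Fin n) F :=
  MvPolynomial.aeval fun x =>
    (A.map (MvPolynomial.C (R := F)) * genericMatrix F n m x.1 *
      B.map (MvPolynomial.C (R := F)) :
        Matrix (Fin n) (Fin n) (MvPolynomial (Fin m × Fin n × Fin n) F)) x.2.1 x.2.2

/-- `R(n, m)`: the polynomials on `m`-tuples of `n × n` matrices that are invariant under
`(X_1, …, X_m) ↦ (A X_1 C⁻¹, …, A X_m C⁻¹)` for all `A, C ∈ SL(n, F)`. -/
noncomputable def semiInvariants (F : Type*) [Field F] (n m : ℕ) :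
    Subalgebra F (MvPolynomial (Fin m × Fin n × Fin n) F) :=
  ⨅ p : Matrix.SpecialLinearGroup (Fin n) F × Matrix.SpecialLinearGroup (Fin n) F,
    AlgHom.equalizer
      (substMatrices m (p.1 : Matrix (Fin n) (Fin n) F)
        ((p.2⁻¹ : Matrix.SpecialLinearGroup (Fin n) F) : Matrix (Fin n) (Fin n) F))
      (AlgHom.id F _)

/-- `R(n, m)` is generated, as an `F`-algebra, by its elements of degree at most `D`. -/
def GeneratedInDegreeLE (F : Type*) [Field F] (n m D : ℕ) : Prop :=
  Algebra.adjoin F {f | f ∈ semiInvariants F n m ∧ f.totalDegree ≤ D} = semiInvariants F n m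

/-! ### The spaces of multilinear bracket monomials -/

/-- The anti-symmetry relations between the symbols `[i_1, …, i_n]`, `i_j ∈ [N]`. -/
inductive BracketRel (F : Type*) [Field F] (n N : ℕ) :
    FreeAlgebra F (Fin n → Fin N) → FreeAlgebra F (Fin n → Fin N) → Prop
  | swap (s : Fin n → Fin N) (a b : Fin n) (hab : a ≠ b) :
      BracketRel F n N (FreeAlgebra.ι F s) (-FreeAlgebra.ι F (s ∘ Equiv.swap a b))

/-- `𝒫`: the noncommutative polynomial ring over `F` in the anti-symmetric symbols
`[i_1, …, i_n]`, `i_j ∈ [N]`. -/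
abbrev BracketAlgebra (F : Type*) [Field F] (n N : ℕ) : Type _ := RingQuot (BracketRel F n N)

/-- The symbol `[s_1, …, s_n]`. -/
noncomputable def bracket (F : Type*) [Field F] {n N : ℕ} (s : Fin n → Fin N) :
    BracketAlgebra F n N :=
  RingQuot.mkAlgHom F (BracketRel F n N) (FreeAlgebra.ι F s)

/-- The degree-`d` monomial `[T_{1,1}, …, T_{1,n}] ∘ ⋯ ∘ [T_{d,1}, …, T_{d,n}]` recorded by the
`d × n` tableau `T`. -/
noncomputable def bracketMonomial (F : Type*) [Field F] {n d N : ℕ}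
    (T : Fin d → Fin n → Fin N) : BracketAlgebra F n N :=
  (List.ofFn fun i => bracket F (T i)).prod

/-- A `d × n` tableau with entries in `[dn]` is repetition-free if every element of `[dn]`
occurs (hence occurs exactly once). -/
def RepetitionFree {n d : ℕ} (T : Fin d → Fin n → Fin (d * n)) : Prop :=
  ∀ k, ∃ i j, T i j = k

/-- `𝒫(d)`: the span of the repetition-free monomials of degree `d`. The space `𝒫̄(d)` built on the
barred symbols is another copy of it. -/
noncomputable def multiBrackets (F : Type*) [Field F] (n d : ℕ) :
    Submodule F (BracketAlgebra F n (d * n)) :=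
  Submodule.span F {x | ∃ T : Fin d → Fin n → Fin (d * n),
    RepetitionFree T ∧ x = bracketMonomial F T}

/-- A repetition-free monomial as an element of `𝒫(d)`. -/
noncomputable def multiMonomial (F : Type*) [Field F] {n d : ℕ} (T : Fin d → Fin n → Fin (d * n))
    (hT : RepetitionFree T) : multiBrackets F n d :=
  ⟨bracketMonomial F T, Submodule.subset_span ⟨T, hT, rfl⟩⟩

/-! ### The map `φ` -/

/-- The Plücker coordinate `(v_1, …, v_N) ↦ det [v_{s_1}, …, v_{s_n}]`. -/
def plucker {F : Type*} [Field F] {n N : ℕ} (s : Fin n → Fin N) (v : Fin N → Fin n → F) : F :=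
  Matrix.det (Matrix.of fun a j => v (s j) a)

theorem plucker_swap {F : Type*} [Field F] {n N : ℕ} (s : Fin n → Fin N) (a b : Fin n)
    (hab : a ≠ b) (v : Fin N → Fin n → F) :
    plucker s v = -plucker (s ∘ Equiv.swap a b) v := by
  have h := Matrix.det_permute' (Equiv.swap a b) (Matrix.of fun c j => v (s j) c)
  rw [Equiv.Perm.sign_swap hab] at h
  have h2 : plucker (s ∘ Equiv.swap a b) v = -plucker s v := by
    simpa [plucker, Matrix.submatrix, Function.comp_def] using h
  rw [h2, neg_neg]

/-- The algebra homomorphism from `𝒫` to functions on `N`-tuples of vectors of `F^n` that replaces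
each symbol by the corresponding Plücker coordinate. -/
noncomputable def bracketEval (F : Type*) [Field F] (n N : ℕ) :
    BracketAlgebra F n N →ₐ[F] ((Fin N → Fin n → F) → F) :=
  RingQuot.liftAlgHom F ⟨FreeAlgebra.lift F fun s => plucker s, by
    rintro _ _ ⟨s, a, b, hab⟩
    funext v
    simpa using plucker_swap s a b hab v⟩

theorem bracketEval_monomial {F : Type*} [Field F] {n d N : ℕ} (T : Fin d → Fin n → Fin N)
    (v : Fin N → Fin n → F) :
    bracketEval F n N (bracketMonomial F T) v = ∏ i, plucker (T i) v := by
  have h : ∀ s : Fin n → Fin N, bracketEval F n N (bracket F s) = plucker s := fun s => by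
    simp [bracketEval, bracket, RingQuot.liftAlgHom_mkAlgHom_apply]
  simp [bracketMonomial, map_list_prod, List.map_ofFn, Function.comp_def, h, List.prod_ofFn]

/-- The linear functional `v ⊗ w ↦ v_a w_b` on `V ⊗ W = F^n ⊗ F^n`. -/
noncomputable def tensorCoord (F : Type*) [Field F] {n : ℕ} (a b : Fin n) :
    (Fin n → F) ⊗[F] (Fin n → F) →ₗ[F] F :=
  LinearMap.mul' F F ∘ₗ TensorProduct.map (LinearMap.proj a) (LinearMap.proj b)

/-- For functions `f`, `g` of `N`-tuples of vectors, the multilinear function on `(V ⊗ W)^N` that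
takes the value `f(e_{a_1}, …, e_{a_N}) g(e_{b_1}, …, e_{b_N})` at
`(e_{a_1} ⊗ e_{b_1}, …, e_{a_N} ⊗ e_{b_N})`. If `f` and `g` are multilinear, this is the multilinear
extension of `(v_1 ⊗ w_1, …, v_N ⊗ w_N) ↦ f(v) g(w)`, see `phi_tmul_apply`. -/
noncomputable def tensorExtend (F : Type*) [Field F] (n N : ℕ) :
    ((Fin N → Fin n → F) → F) →ₗ[F] ((Fin N → Fin n → F) → F) →ₗ[F]
      MultilinearMap F (fun _ : Fin N => (Fin n → F) ⊗[F] (Fin n → F)) F :=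
  LinearMap.mk₂ F
    (fun f g => ∑ a : Fin N → Fin n, ∑ b : Fin N → Fin n,
      (f (fun k => Pi.single (a k) 1) * g (fun k => Pi.single (b k) 1)) •
        (MultilinearMap.mkPiAlgebra F (Fin N) F).compLinearMap
          fun k => tensorCoord F (a k) (b k))
    (fun f f' g => by simp only [Pi.add_apply, add_mul, add_smul, Finset.sum_add_distrib])
    (fun c f g => by simp only [Pi.smul_apply, smul_eq_mul, mul_assoc, mul_smul, Finset.smul_sum])
    (fun f g g' => by simp only [Pi.add_apply, mul_add, add_smul, Finset.sum_add_distrib])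
    (fun c f g => by
      simp only [Pi.smul_apply, smul_eq_mul, mul_left_comm _ c, mul_smul, Finset.smul_sum])

/-- `φ`: the linear map from `𝒫(d) ⊗ 𝒫̄(d)` to multilinear functions on `(V ⊗ W)^{⊕ dn}`, where
`V = W = F^n`. -/
noncomputable def phi (F : Type*) [Field F] (n d : ℕ) :
    multiBrackets F n d ⊗[F] multiBrackets F n d →ₗ[F]
      MultilinearMap F (fun _ : Fin (d * n) => (Fin n → F) ⊗[F] (Fin n → F)) F :=
  TensorProduct.lift ((tensorExtend F n (d * n)).compl₁₂
    ((bracketEval F n (d * n)).toLinearMap ∘ₗ (multiBrackets F n d).subtype)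
    ((bracketEval F n (d * n)).toLinearMap ∘ₗ (multiBrackets F n d).subtype))

theorem prod_plucker_update {F : Type*} [Field F] {n d : ℕ} (T : Fin d → Fin n → Fin (d * n))
    (hT : RepetitionFree T) (i₀ : Fin d) (j₀ : Fin n) (v : Fin (d * n) → Fin n → F)
    (x : Fin n → F) :
    ∏ i, plucker (T i) (Function.update v (T i₀ j₀) x) =
      ((Matrix.of fun a j => v (T i₀ j) a).updateCol j₀ x).det *
        ∏ i ∈ Finset.univ.erase i₀, plucker (T i) v := by
  have hinj : Function.Injective fun p : Fin d × Fin n => T p.1 p.2 := by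
    refine Function.Surjective.injective_of_finite (finProdFinEquiv) fun k => ?_
    obtain ⟨i, j, h⟩ := hT k
    exact ⟨(i, j), h⟩
  rw [← Finset.mul_prod_erase _ _ (Finset.mem_univ i₀)]
  congr 1
  · unfold plucker
    congr 1
    ext a j
    rw [Matrix.updateCol_apply, Matrix.of_apply, Matrix.of_apply]
    by_cases hj : j = j₀
    · simp [hj]
    · have hne : T i₀ j ≠ T i₀ j₀ := fun h => hj (Prod.mk.inj (@hinj (i₀, j) (i₀, j₀) h)).2
      simp [hj, Function.update_of_ne hne]
  · refine Finset.prod_congr rfl fun i hi => ?_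
    unfold plucker
    congr 1
    ext a j
    have hne : T i j ≠ T i₀ j₀ := fun h =>
      (Finset.mem_erase.1 hi).1 (Prod.mk.inj (@hinj (i, j) (i₀, j₀) h)).1
    simp [Function.update_of_ne hne]

/-- The product of the Plücker coordinates of the rows of a repetition-free tableau, as a
multilinear function. -/
def pluckerMultilinear {F : Type*} [Field F] {n d : ℕ} (T : Fin d → Fin n → Fin (d * n))
    (hT : RepetitionFree T) : MultilinearMap F (fun _ : Fin (d * n) => Fin n → F) F where
  toFun v := ∏ i, plucker (T i) v
  map_update_add' {inst} v k x y := by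
    obtain ⟨i, j, rfl⟩ := hT k
    rw [Subsingleton.elim inst (instDecidableEqFin (d * n))]
    simp only [prod_plucker_update T hT, Matrix.det_updateCol_add, add_mul]
  map_update_smul' {inst} v k c x := by
    obtain ⟨i, j, rfl⟩ := hT k
    rw [Subsingleton.elim inst (instDecidableEqFin (d * n))]
    simp only [prod_plucker_update T hT, Matrix.det_updateCol_smul, smul_eq_mul, mul_assoc]

theorem prod_plucker_expand {F : Type*} [Field F] {n d : ℕ} (T : Fin d → Fin n → Fin (d * n))
    (hT : RepetitionFree T) (v : Fin (d * n) → Fin n → F) :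
    ∏ i, plucker (T i) v =
      ∑ a : Fin (d * n) → Fin n, (∏ i, plucker (T i) fun k => Pi.single (a k) (1 : F)) *
        ∏ k, v k (a k) := by
  have hv : v = fun k => ∑ a, v k a • (Pi.single a (1 : F) : Fin n → F) := by
    funext k
    exact pi_eq_sum_univ' (v k)
  have h := (pluckerMultilinear T hT).map_sum
    (fun k a => v k a • (Pi.single a (1 : F) : Fin n → F))
  rw [← hv] at h
  refine h.trans (Finset.sum_congr rfl fun a _ => ?_)
  rw [MultilinearMap.map_smul_univ, smul_eq_mul, mul_comm]
  rfl

/-- `φ` sends `S ⊗ T̄` to the multilinear function whose value at `(v_1 ⊗ w_1, …)` is the product of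
the Plücker coordinates of the rows of `S` at `v` and of the rows of `T` at `w`. -/
theorem phi_tmul_apply {F : Type*} [Field F] {n d : ℕ} (S T : Fin d → Fin n → Fin (d * n))
    (hS : RepetitionFree S) (hT : RepetitionFree T) (v w : Fin (d * n) → Fin n → F) :
    phi F n d (multiMonomial F S hS ⊗ₜ multiMonomial F T hT) (fun k => v k ⊗ₜ w k) =
      (∏ i, plucker (S i) v) * ∏ i, plucker (T i) w := by
  rw [prod_plucker_expand S hS v, prod_plucker_expand T hT w, Finset.sum_mul_sum]
  simp only [phi, TensorProduct.lift.tmul, LinearMap.compl₁₂_apply, tensorExtend,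
    LinearMap.mk₂_apply, sum_apply, smul_apply,
    MultilinearMap.compLinearMap_apply, MultilinearMap.mkPiAlgebra_apply, LinearMap.comp_apply,
    Submodule.subtype_apply, AlgHom.toLinearMap_apply, multiMonomial, bracketEval_monomial,
    tensorCoord, TensorProduct.map_tmul, LinearMap.mul'_apply, LinearMap.proj_apply, smul_eq_mul,
    Finset.prod_mul_distrib]
  refine Finset.sum_congr rfl fun a _ => Finset.sum_congr rfl fun b _ => ?_
  ring

/-! ### Correlated tableaux -/

/-- A correlated tableau of size `d × d`: a `d × d` matrix of (possibly empty) subsets of `[dn]`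
that partition `[dn]`, such that the union of every row and of every column has `n` elements. -/
structure CorrelatedTableau (n d : ℕ) where
  cell : Fin d → Fin d → Finset (Fin (d * n))
  existsUnique_mem : ∀ k, ∃! p : Fin d × Fin d, k ∈ cell p.1 p.2
  card_row : ∀ i, (Finset.univ.biUnion fun j => cell i j).card = n
  card_col : ∀ j, (Finset.univ.biUnion fun i => cell i j).card = n

namespace CorrelatedTableau

variable {n d : ℕ}

/-- The transposed correlated tableau. -/
def transpose (C : CorrelatedTableau n d) : CorrelatedTableau n d where
  cell i j := C.cell j i
  existsUnique_mem k := by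
    obtain ⟨p, hp, hu⟩ := C.existsUnique_mem k
    refine ⟨p.swap, hp, fun q hq => ?_⟩
    rw [← hu q.swap hq, Prod.swap_swap]
  card_row := C.card_col
  card_col := C.card_row

/-- The `i`-th row of `C` read from left to right, each entry in increasing order. -/
def rowWord (C : CorrelatedTableau n d) (i : Fin d) : List (Fin (d * n)) :=
  (List.finRange d).flatMap fun j => (C.cell i j).sort (· ≤ ·)

theorem length_rowWord (C : CorrelatedTableau n d) (i : Fin d) : (C.rowWord i).length = n := by
  have h : (C.rowWord i).length = ∑ j, (C.cell i j).card := by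
    simp [rowWord, List.length_flatMap, Fin.sum_univ_def]
  rw [h, ← Finset.card_biUnion, C.card_row i]
  intro j _ j' _ hjj'
  rw [Function.onFun, Finset.disjoint_left]
  intro k hk hk'
  have := (C.existsUnique_mem k).unique (y₁ := (i, j)) (y₂ := (i, j')) hk hk'
  exact hjj' (Prod.mk.inj this).2

/-- The `d × n` tableau obtained by reading `C` along the rows, from top to bottom. -/
def rowReading (C : CorrelatedTableau n d) (i : Fin d) (k : Fin n) : Fin (d * n) :=
  (C.rowWord i).get (k.cast (C.length_rowWord i).symm)

theorem repetitionFree_rowReading (C : CorrelatedTableau n d) : RepetitionFree C.rowReading := by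
  intro k
  obtain ⟨p, hp, -⟩ := C.existsUnique_mem k
  have hk : k ∈ C.rowWord p.1 := by
    simp only [rowWord, List.mem_flatMap, List.mem_finRange, Finset.mem_sort, true_and]
    exact ⟨p.2, hp⟩
  obtain ⟨l, hl⟩ := List.get_of_mem hk
  exact ⟨p.1, l.cast (C.length_rowWord p.1), hl⟩

/-- The `d × n` tableau obtained by reading `C` along the columns, from left to right. -/
def colReading (C : CorrelatedTableau n d) : Fin d → Fin n → Fin (d * n) :=
  C.transpose.rowReading

theorem repetitionFree_colReading (C : CorrelatedTableau n d) : RepetitionFree C.colReading :=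
  C.transpose.repetitionFree_rowReading

/-- The element `S ⊗ T̄` of `𝒫(d) ⊗ 𝒫̄(d)` that corresponds to `C`. -/
noncomputable def toTensor (F : Type*) [Field F] (C : CorrelatedTableau n d) :
    multiBrackets F n d ⊗[F] multiBrackets F n d :=
  multiMonomial F C.rowReading C.repetitionFree_rowReading ⊗ₜ
    multiMonomial F C.colReading C.repetitionFree_colReading

/-- The bipartite graph of `C` on `L ∪ R`, `L = R = [d]`: it joins `i ∈ L` to `j ∈ R` if
`C(i, j) ≠ ∅`. Edge multiplicities are irrelevant to connectedness and are not recorded. -/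
def graph (C : CorrelatedTableau n d) : SimpleGraph (Fin d ⊕ Fin d) :=
  SimpleGraph.fromRel fun x y => ∃ i j, x = Sum.inl i ∧ y = Sum.inr j ∧ (C.cell i j).Nonempty

end CorrelatedTableau

/-- `𝔇(d)`: the span of the correlated tableaux whose graph is disconnected. -/
noncomputable def disconnectedSpan (F : Type*) [Field F] (n d : ℕ) :
    Submodule F (multiBrackets F n d ⊗[F] multiBrackets F n d) :=
  Submodule.span F {x | ∃ C : CorrelatedTableau n d, ¬ C.graph.Connected ∧ x = C.toTensor F}

/-- `𝔇(d) ∪ ker φ` spans `𝒫(d) ⊗ 𝒫̄(d)`. -/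
def DisconnectedSpans (F : Type*) [Field F] (n d : ℕ) : Prop :=
  Submodule.span F ((disconnectedSpan F n d : Set (multiBrackets F n d ⊗[F] multiBrackets F n d)) ∪
    (LinearMap.ker (phi F n d) : Set (multiBrackets F n d ⊗[F] multiBrackets F n d))) = ⊤

/-! Both conditions are compared with the polynomials `pairInvariant S T κ`, obtained by
substituting generic matrices into the multilinear functions `φ(S ⊗ T̄)`. In matrix coordinates such
a function is `doubleDet S T`, a signed sum over row and column permutations.

The first fundamental theorem (`mem_pairSpan`) says that these polynomials span the semi-invariants
of degree `dn`. A homogeneous semi-invariant satisfies `f(AX) = det(A)^d f(X)` with `dn` its degree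
(`genericLeft_eq`). Cayley's operator in `A` therefore multiplies `f` by a constant, which is
positive by `cayleyConstant_pos`; applied on both sides, it sends every monomial of degree `dn` into
the span of the `pairInvariant`s.

A disconnected pair of fillings is a disjoint union of two smaller pairs, so its `doubleDet` is a
product (`doubleDet_of_disconnected`). If disconnected tableaux span modulo `ker φ`, then every
semi-invariant of degree `dn > bn` is a combination of products of semi-invariants of smaller
degree, and induction on the degree gives (i).

Conversely, generation in degree at most `bn` makes each `pairInvariant` of degree `dn > bn`
decomposable, hence a combination of disconnected ones (`decomposables_le`). To return to
multilinear functions, let `L` be the sum over all `κ` of restitution followed by polarization. It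
maps the span of all pairs into the span of the disconnected ones. It is injective when `m ≥ n²`, by
positivity of an integral Gram-type matrix (`det_gramMatrix_ne_zero`). Comparing dimensions shows
that the two spans agree. -/

/-! ### Products of determinants in two sets of variables -/

/-- The product of the signs of a family of permutations. -/
def signProd (R : Type*) [CommRing R] {D : Type*} [Fintype D] {n : ℕ}
    (σ : D → Equiv.Perm (Fin n)) : R :=
  ∏ i, ((Equiv.Perm.sign (σ i) : ℤ) : R)

theorem map_signProd {R R' D : Type*} [CommRing R] [CommRing R'] [Fintype D] {n : ℕ}
    (f : R →+* R') (σ : D → Equiv.Perm (Fin n)) :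
    f (signProd R σ) = signProd R' σ := by
  simp [signProd]

theorem signProd_mul {R D : Type*} [CommRing R] [Fintype D] {n : ℕ}
    (σ τ : D → Equiv.Perm (Fin n)) :
    signProd R (fun i => σ i * τ i) = signProd R σ * signProd R τ := by
  simp [signProd, Finset.prod_mul_distrib]

/-- The disjoint union of two fillings. -/
def sumFilling {ι ι' D E : Type*} {n : ℕ} (S : ι ≃ D × Fin n) (S' : ι' ≃ E × Fin n) : ι ⊕ ι' ≃ (D ⊕ E) × Fin n :=
  (Equiv.sumCongr S S').trans (Equiv.sumProdDistrib D E (Fin n)).symm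

/-- A pair of fillings is disconnected if some nontrivial set of rows of the first one contains the
same elements as some set of rows of the second one. -/
def DisconnectedPair {ι D D' : Type*} {n : ℕ} (S : ι ≃ D × Fin n) (T : ι ≃ D' × Fin n) : Prop :=
  ∃ (P : D → Prop) (P' : D' → Prop), (∀ k, P (S k).1 ↔ P' (T k).1) ∧ (∃ i, P i) ∧ ∃ i, ¬P i

theorem disconnectedPair_sumFilling {ι ι' D D' E E' : Type*} {n : ℕ}
    [Nonempty D] [Nonempty E] (S : ι ≃ D × Fin n)
    (T : ι ≃ D' × Fin n) (S' : ι' ≃ E × Fin n) (T' : ι' ≃ E' × Fin n) :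
    DisconnectedPair (sumFilling S S') (sumFilling T T') := by
  refine ⟨fun i => i.isLeft = true, fun i => i.isLeft = true, ?_,
    ⟨Sum.inl (Classical.arbitrary D), rfl⟩, ⟨Sum.inr (Classical.arbitrary E), by simp⟩⟩
  rintro (k | k) <;> simp [sumFilling]

section DoubleDet

variable {R R' ι ι' D D' E E' : Type*} [CommRing R] [CommRing R'] {n : ℕ}
  [Fintype ι] [Fintype ι'] [Fintype D] [DecidableEq D] [Fintype D'] [DecidableEq D']
  [Fintype E] [DecidableEq E] [Fintype E'] [DecidableEq E']

/-- The blocks of `ι`, in the order given by `S`, contribute the determinants of the vectors that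
they index. -/
theorem sum_signProd_mul_prod (S : ι ≃ D × Fin n) (v : ι → Fin n → R) :
    ∑ σ : D → Equiv.Perm (Fin n), signProd R σ * ∏ k, v k (σ (S k).1 (S k).2) =
      ∏ i, (Matrix.of fun a j => v (S.symm (i, j)) a).det := by
  simp only [Matrix.det_apply']
  rw [Finset.prod_univ_sum, Fintype.piFinset_univ]
  refine Finset.sum_congr rfl fun σ _ => ?_
  rw [Finset.prod_mul_distrib, signProd]
  congr 1
  rw [← S.symm.prod_comp, Fintype.prod_prod_type]
  simp

/-- The sum of products that represents, in matrix coordinates, the multilinear function attached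
to a pair of fillings: `S` places the elements of `ι` in rows indexed by `D`, and `T` in rows
indexed by `D'`. -/
def doubleDet (S : ι ≃ D × Fin n) (T : ι ≃ D' × Fin n) (Y : ι → Matrix (Fin n) (Fin n) R) : R :=
  ∑ σ : D → Equiv.Perm (Fin n), ∑ τ : D' → Equiv.Perm (Fin n),
    signProd R σ * signProd R τ * ∏ k, Y k (σ (S k).1 (S k).2) (τ (T k).1 (T k).2)

theorem map_doubleDet (f : R →+* R') (S : ι ≃ D × Fin n) (T : ι ≃ D' × Fin n)
    (Y : ι → Matrix (Fin n) (Fin n) R) :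
    f (doubleDet S T Y) = doubleDet S T fun k => (Y k).map f := by
  simp [doubleDet, map_signProd, map_sum, map_prod]

theorem doubleDet_transpose (S : ι ≃ D × Fin n) (T : ι ≃ D' × Fin n)
    (Y : ι → Matrix (Fin n) (Fin n) R) :
    doubleDet S T (fun k => (Y k).transpose) = doubleDet T S Y := by
  simp only [doubleDet, Matrix.transpose_apply]
  rw [Finset.sum_comm]
  exact Finset.sum_congr rfl fun σ _ => Finset.sum_congr rfl fun τ _ => by
    rw [mul_comm (signProd R τ)]

/-- For fixed `τ` the sum over `σ` collapses to one determinant per row of `S`. This form makes the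
effect of multiplying all matrices on the left visible. -/
theorem doubleDet_eq_sum_prod_det (S : ι ≃ D × Fin n) (T : ι ≃ D' × Fin n)
    (Y : ι → Matrix (Fin n) (Fin n) R) :
    doubleDet S T Y = ∑ τ : D' → Equiv.Perm (Fin n), signProd R τ *
      ∏ i, (Matrix.of fun a j =>
        Y (S.symm (i, j)) a (τ (T (S.symm (i, j))).1 (T (S.symm (i, j))).2)).det := by
  rw [doubleDet, Finset.sum_comm]
  refine Finset.sum_congr rfl fun τ _ => ?_
  rw [← sum_signProd_mul_prod S fun k a => Y k a (τ (T k).1 (T k).2), Finset.mul_sum]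
  exact Finset.sum_congr rfl fun σ _ => by ring

theorem doubleDet_mul_left (S : ι ≃ D × Fin n) (T : ι ≃ D' × Fin n)
    (A : Matrix (Fin n) (Fin n) R) (Y : ι → Matrix (Fin n) (Fin n) R) :
    doubleDet S T (fun k => A * Y k) = A.det ^ Fintype.card D * doubleDet S T Y := by
  simp only [doubleDet_eq_sum_prod_det, Finset.mul_sum]
  refine Finset.sum_congr rfl fun τ _ => ?_
  rw [mul_left_comm]
  congr 1
  rw [Fintype.card, ← Finset.prod_const, ← Finset.prod_mul_distrib]
  refine Finset.prod_congr rfl fun i _ => ?_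
  rw [← Matrix.det_mul]
  congr 1

theorem doubleDet_mul_right (S : ι ≃ D × Fin n) (T : ι ≃ D' × Fin n)
    (B : Matrix (Fin n) (Fin n) R) (Y : ι → Matrix (Fin n) (Fin n) R) :
    doubleDet S T (fun k => Y k * B) = B.det ^ Fintype.card D' * doubleDet S T Y := by
  rw [← doubleDet_transpose, ← doubleDet_transpose T S Y]
  simp only [Matrix.transpose_mul]
  rw [doubleDet_mul_left, Matrix.det_transpose]

theorem doubleDet_reindex (S : ι ≃ D × Fin n) (T : ι ≃ D' × Fin n) (S' : ι' ≃ E × Fin n)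
    (T' : ι' ≃ E' × Fin n) (e : ι' ≃ ι) (f : E ≃ D) (f' : E' ≃ D')
    (hS : ∀ k, S (e k) = (f (S' k).1, (S' k).2)) (hT : ∀ k, T (e k) = (f' (T' k).1, (T' k).2))
    (Y : ι → Matrix (Fin n) (Fin n) R) :
    doubleDet S T Y = doubleDet S' T' fun k => Y (e k) := by
  have hs : ∀ σ : D → Equiv.Perm (Fin n), signProd R (fun i => σ (f i)) = signProd R σ :=
    fun σ => f.prod_comp fun i => ((Equiv.Perm.sign (σ i) : ℤ) : R)
  have hs' : ∀ σ : D' → Equiv.Perm (Fin n), signProd R (fun i => σ (f' i)) = signProd R σ :=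
    fun σ => f'.prod_comp fun i => ((Equiv.Perm.sign (σ i) : ℤ) : R)
  refine Fintype.sum_equiv (f.symm.arrowCongr (Equiv.refl _)) _ _ fun σ => ?_
  refine Fintype.sum_equiv (f'.symm.arrowCongr (Equiv.refl _)) _ _ fun τ => ?_
  rw [← hs, ← hs', ← e.prod_comp]
  simp only [hS, hT]
  rfl

/-- Row permutations of a disjoint union are pairs of row permutations, so the signed sum factors.
This is the source of all decompositions into products. -/
theorem doubleDet_sumFilling (S : ι ≃ D × Fin n) (T : ι ≃ D' × Fin n) (S' : ι' ≃ E × Fin n)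
    (T' : ι' ≃ E' × Fin n) (Y : ι ⊕ ι' → Matrix (Fin n) (Fin n) R) :
    doubleDet (sumFilling S S') (sumFilling T T') Y =
      doubleDet S T (fun k => Y (Sum.inl k)) * doubleDet S' T' fun k => Y (Sum.inr k) := by
  simp only [doubleDet]
  rw [Finset.sum_mul_sum, ← (Equiv.sumArrowEquivProdArrow D E _).symm.sum_comp,
    Fintype.sum_prod_type]
  refine Finset.sum_congr rfl fun σ _ => Finset.sum_congr rfl fun σ' _ => ?_
  rw [Finset.sum_mul_sum, ← (Equiv.sumArrowEquivProdArrow D' E' _).symm.sum_comp,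
    Fintype.sum_prod_type]
  refine Finset.sum_congr rfl fun τ _ => Finset.sum_congr rfl fun τ' _ => ?_
  rw [Fintype.prod_sum_type]
  simp only [signProd, Fintype.prod_sum_type]
  simp only [sumFilling, Equiv.sumArrowEquivProdArrow, Equiv.coe_fn_symm_mk, Sum.elim_inl,
    Sum.elim_inr, Equiv.trans_apply, Equiv.sumCongr_apply, Sum.map_inl, Sum.map_inr,
    Equiv.sumProdDistrib_symm_apply_left, Equiv.sumProdDistrib_symm_apply_right]
  ring

/-- At rank-one matrices the dependence on `σ` and on `τ` separates. This identifies `doubleDet`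
with the value of `φ` on pure tensors. -/
theorem doubleDet_vecMulVec (S : ι ≃ D × Fin n) (T : ι ≃ D' × Fin n) (v w : ι → Fin n → R) :
    doubleDet S T (fun k => Matrix.vecMulVec (v k) (w k)) =
      (∏ i, (Matrix.of fun a j => v (S.symm (i, j)) a).det) *
        ∏ i, (Matrix.of fun a j => w (T.symm (i, j)) a).det := by
  rw [← sum_signProd_mul_prod, ← sum_signProd_mul_prod, Finset.sum_mul_sum]
  refine Finset.sum_congr rfl fun σ _ => Finset.sum_congr rfl fun τ _ => ?_
  simp only [Matrix.vecMulVec_apply, Finset.prod_mul_distrib]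
  ring

/-- Multilinear expansion of `doubleDet` in the matrix units. -/
theorem doubleDet_expand [DecidableEq ι] {K : Type*} [CommRing K] [Algebra K R]
    (S : ι ≃ D × Fin n) (T : ι ≃ D' × Fin n) (Y : ι → Matrix (Fin n) (Fin n) R) :
    doubleDet S T Y = ∑ s : ι → Fin n × Fin n,
      doubleDet S T (fun k => Matrix.single (s k).1 (s k).2 (1 : K)) •
        ∏ k, Y k (s k).1 (s k).2 := by
  have key : ∀ g : ι → Fin n × Fin n, ∏ k, Y k (g k).1 (g k).2 =
      ∑ s : ι → Fin n × Fin n, (∏ k, (Matrix.single (s k).1 (s k).2 (1 : K)) (g k).1 (g k).2) •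
        ∏ k, Y k (s k).1 (s k).2 := by
    intro g
    rw [Finset.sum_eq_single g]
    · simp
    · intro s _ hs
      obtain ⟨k, hk⟩ := Function.ne_iff.1 hs
      rw [Finset.prod_eq_zero (Finset.mem_univ k), zero_smul]
      rw [Matrix.single_apply, if_neg]
      exact fun h => hk (Prod.ext h.1 h.2)
    · simp
  simp only [doubleDet, Finset.sum_smul]
  conv_rhs => rw [Finset.sum_comm]
  refine Finset.sum_congr rfl fun σ _ => ?_
  conv_rhs => rw [Finset.sum_comm]
  refine Finset.sum_congr rfl fun τ _ => ?_
  rw [key fun k => (σ (S k).1 (S k).2, τ (T k).1 (T k).2), Finset.mul_sum]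
  refine Finset.sum_congr rfl fun s _ => ?_
  rw [mul_smul, Algebra.smul_def (signProd K σ * signProd K τ), map_mul, map_signProd,
    map_signProd]

/-- Rearranging the rows of the first filling changes `doubleDet` by a sign only. -/
theorem doubleDet_rearrange_left (S S' : ι ≃ D × Fin n) (h : ∀ k, (S' k).1 = (S k).1) :
    ∃ ρ : D → Equiv.Perm (Fin n), ∀ (T : ι ≃ D' × Fin n) (Y : ι → Matrix (Fin n) (Fin n) R),
      doubleDet S' T Y = signProd R ρ * doubleDet S T Y := by
  have h' : ∀ i j, (S' (S.symm (i, j))).1 = i := fun i j => by rw [h, S.apply_symm_apply]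
  have h'' : ∀ i j, (S (S'.symm (i, j))).1 = i := fun i j => by rw [← h, S'.apply_symm_apply]
  -- `ρ i` sends the position of an element in row `i` of `S'` to its position in the same row of
  -- `S`. The substitution `σ ↦ σ * ρ` then turns one sum into the other.
  let ρ : D → Equiv.Perm (Fin n) := fun i =>
    { toFun := fun j => (S (S'.symm (i, j))).2
      invFun := fun j => (S' (S.symm (i, j))).2
      left_inv := fun j => by
        have : (i, (S (S'.symm (i, j))).2) = S (S'.symm (i, j)) := Prod.ext (h'' i j).symm rfl
        simp only [this, S.symm_apply_apply, S'.apply_symm_apply]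
      right_inv := fun j => by
        have : (i, (S' (S.symm (i, j))).2) = S' (S.symm (i, j)) := Prod.ext (h' i j).symm rfl
        simp only [this, S'.symm_apply_apply, S.apply_symm_apply] }
  have hρ : ∀ k, ρ (S k).1 (S' k).2 = (S k).2 := fun k => by
    change (S (S'.symm ((S k).1, (S' k).2))).2 = _
    rw [← h, Prod.mk.eta, S'.symm_apply_apply]
  refine ⟨ρ, fun T Y => ?_⟩
  rw [doubleDet, doubleDet, Finset.mul_sum]
  refine (Fintype.sum_equiv (Equiv.mulRight ρ) _ _ fun σ => ?_).symm
  rw [Finset.mul_sum]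
  refine Finset.sum_congr rfl fun τ _ => ?_
  have e1 : signProd R (σ * ρ) = signProd R σ * signProd R ρ := signProd_mul σ ρ
  rw [Equiv.coe_mulRight, e1]
  simp only [h, Pi.mul_apply, Equiv.Perm.mul_apply, hρ]
  ring

theorem doubleDet_rearrange (S S' : ι ≃ D × Fin n) (T T' : ι ≃ D' × Fin n)
    (hS : ∀ k, (S' k).1 = (S k).1) (hT : ∀ k, (T' k).1 = (T k).1) :
    ∃ c : R, ∀ Y : ι → Matrix (Fin n) (Fin n) R, doubleDet S T Y = c * doubleDet S' T' Y := by
  obtain ⟨ρ, hρ⟩ := doubleDet_rearrange_left (D' := D') (R := R) S' S fun k => (hS k).symm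
  obtain ⟨ρ', hρ'⟩ := doubleDet_rearrange_left (D' := D) (R := R) T' T fun k => (hT k).symm
  refine ⟨signProd R ρ * signProd R ρ', fun Y => ?_⟩
  rw [hρ, ← doubleDet_transpose, hρ', doubleDet_transpose, mul_assoc]

/-- The part of a filling that consists of the rows satisfying `P`. -/
def restrictFilling (S : ι ≃ D × Fin n) (P : D → Prop) (Q : ι → Prop)
    (h : ∀ k, Q k ↔ P (S k).1) : {k // Q k} ≃ {i // P i} × Fin n where
  toFun k := (⟨(S k).1, (h k).1 k.2⟩, (S k).2)
  invFun p := ⟨S.symm (p.1, p.2), (h _).2 (by rw [S.apply_symm_apply]; exact p.1.2)⟩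
  left_inv k := by simp
  right_inv p := by simp

/-- Up to relabelling, the fillings are disjoint unions of their restrictions to the selected rows
and to the remaining ones. -/
theorem doubleDet_of_disconnected (S : ι ≃ D × Fin n) (T : ι ≃ D' × Fin n)
    (P : D → Prop) (P' : D' → Prop) [DecidablePred P] [DecidablePred P']
    (h : ∀ k, P (S k).1 ↔ P' (T k).1) (Y : ι → Matrix (Fin n) (Fin n) R) :
    doubleDet S T Y =
      doubleDet (restrictFilling S P (fun k => P (S k).1) fun _ => Iff.rfl)
        (restrictFilling T P' (fun k => P (S k).1) h) (fun k => Y k) *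
      doubleDet (restrictFilling S (fun i => ¬P i) (fun k => ¬P (S k).1) fun _ => Iff.rfl)
        (restrictFilling T (fun i => ¬P' i) (fun k => ¬P (S k).1) fun k => not_congr (h k))
        (fun k => Y k) := by
  rw [doubleDet_reindex S T
    (sumFilling (restrictFilling S P (fun k => P (S k).1) fun _ => Iff.rfl)
      (restrictFilling S (fun i => ¬P i) (fun k => ¬P (S k).1) fun _ => Iff.rfl))
    (sumFilling (restrictFilling T P' (fun k => P (S k).1) h)
      (restrictFilling T (fun i => ¬P' i) (fun k => ¬P (S k).1) fun k => not_congr (h k)))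
    (Equiv.sumCompl fun k => P (S k).1) (Equiv.sumCompl P) (Equiv.sumCompl P') ?_ ?_ Y]
  · exact doubleDet_sumFilling _ _ _ _ _
  · rintro (k | k) <;> rfl
  · rintro (k | k) <;> rfl

end DoubleDet

/-! ### Polarization of polynomials -/

/-- The exponent at `l` on the left counts the fibre of `g` over `l`. -/
theorem sum_single_eq_iff_bijective {ι ι' : Type*} [Fintype ι] [DecidableEq ι]
    [Fintype ι'] (g : ι' → ι) :
    (∑ k, Finsupp.single (g k) 1 : ι →₀ ℕ) = ∑ l, Finsupp.single l 1 ↔ Function.Bijective g := by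
  constructor
  · intro h
    rw [Function.bijective_iff_existsUnique]
    intro l
    have hl := DFunLike.congr_fun h l
    simp only [Finsupp.coe_finsetSum, Finset.sum_apply, Finsupp.single_apply,
      Finset.sum_ite_eq', Finset.mem_univ, if_true] at hl
    rw [Finset.sum_boole, Nat.cast_id, Finset.card_eq_one] at hl
    obtain ⟨k, hk⟩ := hl
    refine ⟨k, by simpa using (Finset.ext_iff.1 hk k).2 (by simp), fun k' hk' => ?_⟩
    simpa using (Finset.ext_iff.1 hk k').1 (by simpa using hk')
  · intro h
    exact (Equiv.ofBijective g h).sum_comp fun l => (Finsupp.single l 1 : ι →₀ ℕ)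

section Polarization

variable {R ι ι' X : Type*} [CommRing R] [Fintype ι] [DecidableEq ι] [Fintype ι']
  [DecidableEq ι'] [Fintype X] [DecidableEq X]

/-- The value at the unit vectors given by `x` of the full polarization of a polynomial. -/
noncomputable def polar (R : Type*) [CommRing R] (x : ι → X) : MvPolynomial X R →ₗ[R] R :=
  -- Reading off the squarefree coefficient after this substitution amounts to differentiating once
  -- in the direction `x l` for each `l` and evaluating at zero.
  MvPolynomial.lcoeff R (∑ l, Finsupp.single l 1) ∘ₗ
    (MvPolynomial.aeval fun y => ∑ l with x l = y, MvPolynomial.X l :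
      MvPolynomial X R →ₐ[R] MvPolynomial ι R).toLinearMap

/-- Expanding the product gives one term for each map `g` from factors to variables. Only bijective
`g` produce the squarefree monomial, so the result is a permanent. -/
theorem polar_prod (x : ι → X) (c : ι' → X → R) :
    polar R x (∏ k, ∑ y, MvPolynomial.C (c k y) * MvPolynomial.X y) =
      ∑ π : ι' ≃ ι, ∏ k, c k (x (π k)) := by
  have h1 : ∀ k, ∑ y, (MvPolynomial.C (c k y) * ∑ l with x l = y, MvPolynomial.X l :
      MvPolynomial ι R) = ∑ l, MvPolynomial.C (c k (x l)) * MvPolynomial.X l := by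
    intro k
    rw [← Finset.sum_fiberwise Finset.univ x]
    refine Finset.sum_congr rfl fun y _ => ?_
    rw [Finset.mul_sum]
    refine Finset.sum_congr rfl fun l hl => ?_
    rw [(Finset.mem_filter.1 hl).2]
  have h2 : ∀ g : ι' → ι, (∏ k, (MvPolynomial.C (c k (x (g k))) * MvPolynomial.X (g k)) :
      MvPolynomial ι R) =
        MvPolynomial.monomial (∑ k, Finsupp.single (g k) 1) (∏ k, c k (x (g k))) := by
    intro g
    rw [Finset.prod_mul_distrib, ← map_prod, ← mul_one (∏ k, c k (x (g k))),
      ← MvPolynomial.C_mul_monomial, MvPolynomial.monomial_sum_one, mul_one]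
    rfl
  simp only [polar, LinearMap.comp_apply, AlgHom.toLinearMap_apply, map_prod, map_sum, map_mul,
    MvPolynomial.aeval_X, MvPolynomial.algHom_C, MvPolynomial.algebraMap_eq, h1]
  rw [Finset.prod_univ_sum, Fintype.piFinset_univ, map_sum]
  simp only [h2, MvPolynomial.lcoeff_apply, MvPolynomial.coeff_monomial]
  symm
  refine Fintype.sum_of_injective (fun π : ι' ≃ ι => (π : ι' → ι)) DFunLike.coe_injective _ _ ?_ ?_
  · intro g hg
    rw [if_neg]
    intro h
    exact hg ⟨Equiv.ofBijective g ((sum_single_eq_iff_bijective g).1 h), rfl⟩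
  · intro π
    rw [if_pos ((sum_single_eq_iff_bijective _).2 π.bijective)]

theorem polar_prod_X (x : ι → X) (y : ι' → X) :
    polar R x (∏ k, MvPolynomial.X (y k)) =
      ∑ π : ι' ≃ ι, if ∀ k, y k = x (π k) then 1 else 0 := by
  have h := polar_prod (R := R) x fun k z => if y k = z then 1 else 0
  simp only [apply_ite MvPolynomial.C, MvPolynomial.C_1, MvPolynomial.C_0, ite_mul, one_mul,
    zero_mul, Finset.sum_ite_eq, Finset.mem_univ, if_true] at h
  rw [h]
  refine Finset.sum_congr rfl fun π _ => ?_
  rw [Finset.prod_ite_zero]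
  simp

end Polarization

/-! ### The `d`-th power of Cayley's operator -/

section Cayley

variable {R : Type*} [CommRing R] {n d : ℕ}

/-- The positions of the term of `det ^ d` given by `σ`. -/
def diagonalTerm (σ : Fin d → Equiv.Perm (Fin n)) (p : Fin d × Fin n) : Fin n × Fin n :=
  (p.2, σ p.1 p.2)

/-- The `d`-th power of Cayley's operator, followed by evaluation at zero. -/
noncomputable def cayley (R : Type*) [CommRing R] (n d : ℕ) :
    MvPolynomial (Fin n × Fin n) R →ₗ[R] R :=
  ∑ σ : Fin d → Equiv.Perm (Fin n), signProd R σ • polar R (diagonalTerm σ)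

theorem cayley_prod {ι : Type*} [Fintype ι] [DecidableEq ι] (a : ι → Fin n)
    (v : ι → Fin n → R) :
    cayley R n d (∏ k, ∑ s, MvPolynomial.X (a k, s) * MvPolynomial.C (v k s)) =
      ∑ π : ι ≃ Fin d × Fin n, if ∀ k, a k = (π k).2 then
        ∑ σ : Fin d → Equiv.Perm (Fin n), signProd R σ * ∏ k, v k (σ (π k).1 (π k).2) else 0 := by
  have h : ∀ k, (∑ s, MvPolynomial.X (a k, s) * MvPolynomial.C (v k s) :
      MvPolynomial (Fin n × Fin n) R) =
        ∑ y : Fin n × Fin n, MvPolynomial.C (if a k = y.1 then v k y.2 else 0) *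
          MvPolynomial.X y := by
    intro k
    symm
    rw [Fintype.sum_prod_type, Finset.sum_eq_single (a k)]
    · simp [mul_comm]
    · intro b _ hb
      simp [Ne.symm hb]
    · simp
  simp only [h, cayley, LinearMap.sum_apply, LinearMap.smul_apply, polar_prod, smul_eq_mul,
    Finset.mul_sum]
  rw [Finset.sum_comm]
  refine Finset.sum_congr rfl fun π _ => ?_
  split_ifs with hπ
  · refine Finset.sum_congr rfl fun σ _ => ?_
    congr 1
    exact Finset.prod_congr rfl fun k _ => by simp [diagonalTerm, hπ k]
  · refine Finset.sum_eq_zero fun σ _ => ?_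
    push Not at hπ
    obtain ⟨k, hk⟩ := hπ
    rw [Finset.prod_eq_zero (Finset.mem_univ k), mul_zero]
    simp [diagonalTerm, hk]

/-- The value of the `d`-th power of Cayley's operator at `det ^ d`. -/
def cayleyConstant (n d : ℕ) : ℤ :=
  ∑ τ : Fin d → Equiv.Perm (Fin n), signProd ℤ τ *
    ∑ σ : Fin d → Equiv.Perm (Fin n), signProd ℤ σ *
      ∑ π : Equiv.Perm (Fin d × Fin n),
        if ∀ k, diagonalTerm τ k = diagonalTerm σ (π k) then 1 else 0

theorem cayley_det_pow :
    cayley R n d ((Matrix.of fun i j => MvPolynomial.X (i, j)).det ^ d) = cayleyConstant n d := by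
  have h : ((Matrix.of fun i j : Fin n => (MvPolynomial.X (i, j) :
      MvPolynomial (Fin n × Fin n) R)).det ^ d) = ∑ τ : Fin d → Equiv.Perm (Fin n),
        signProd R τ • ∏ k, MvPolynomial.X (diagonalTerm τ k) := by
    rw [← Matrix.det_transpose, Matrix.det_apply', ← Fin.prod_const, Finset.prod_univ_sum,
      Fintype.piFinset_univ]
    refine Finset.sum_congr rfl fun τ _ => ?_
    rw [Finset.prod_mul_distrib, Fintype.prod_prod_type, MvPolynomial.smul_eq_C_mul,
      map_signProd MvPolynomial.C]
    rfl
  rw [h, map_sum, cayleyConstant, Int.cast_sum]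
  refine Finset.sum_congr rfl fun τ _ => ?_
  have hs : ∀ σ : Fin d → Equiv.Perm (Fin n), ((signProd ℤ σ : ℤ) : R) = signProd R σ :=
    fun σ => map_signProd (Int.castRingHom R) σ
  rw [map_smul, cayley, LinearMap.sum_apply, Int.cast_mul, Int.cast_sum, smul_eq_mul, hs]
  congr 1
  refine Finset.sum_congr rfl fun σ _ => ?_
  rw [LinearMap.smul_apply, polar_prod_X, Int.cast_mul, hs, smul_eq_mul]
  congr 1
  simp

/-- The constant is a sum of squares up to a positive factor. Let `W y` be the signed number of ways
to write `y` as a permuted term of `det ^ d`. As `W` is invariant under permuting `y`, the sum of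
all `W y ^ 2` equals `(dn)!` times the constant. -/
theorem cayleyConstant_pos (n d : ℕ) : 0 < cayleyConstant n d := by
  let W : (Fin d × Fin n → Fin n × Fin n) → ℤ := fun y =>
    ∑ σ : Fin d → Equiv.Perm (Fin n), signProd ℤ σ *
      ∑ π : Equiv.Perm (Fin d × Fin n), if ∀ k, y k = diagonalTerm σ (π k) then 1 else 0
  have hW : ∀ y (ρ : Equiv.Perm (Fin d × Fin n)), W (fun k => y (ρ k)) = W y := by
    intro y ρ
    refine Finset.sum_congr rfl fun σ _ => ?_
    congr 1
    refine Fintype.sum_equiv (Equiv.mulRight ρ⁻¹) _ _ fun π => ?_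
    refine if_congr ⟨fun h k => ?_, fun h k => ?_⟩ rfl rfl
    · simpa using h (ρ⁻¹ k)
    · simpa using h (ρ k)
  have hsq : ∑ y, W y ^ 2 = Fintype.card (Equiv.Perm (Fin d × Fin n)) * cayleyConstant n d := by
    calc ∑ y, W y ^ 2 = ∑ y, ∑ σ : Fin d → Equiv.Perm (Fin n),
          ∑ π : Equiv.Perm (Fin d × Fin n),
            if y = (fun k => diagonalTerm σ (π k)) then signProd ℤ σ * W y else 0 := by
          refine Finset.sum_congr rfl fun y _ => ?_
          rw [sq]
          nth_rewrite 1 [show W y = ∑ σ : Fin d → Equiv.Perm (Fin n), signProd ℤ σ *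
            ∑ π : Equiv.Perm (Fin d × Fin n), if ∀ k, y k = diagonalTerm σ (π k) then 1 else 0
            from rfl]
          rw [Finset.sum_mul]
          refine Finset.sum_congr rfl fun σ _ => ?_
          rw [mul_assoc, Finset.sum_mul, Finset.mul_sum]
          refine Finset.sum_congr rfl fun π _ => ?_
          simp only [funext_iff, ite_mul, one_mul, zero_mul, mul_ite, mul_zero]
      _ = ∑ σ : Fin d → Equiv.Perm (Fin n), ∑ π : Equiv.Perm (Fin d × Fin n),
            signProd ℤ σ * W (diagonalTerm σ) := by
          rw [Finset.sum_comm]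
          refine Finset.sum_congr rfl fun σ _ => ?_
          rw [Finset.sum_comm]
          refine Finset.sum_congr rfl fun π _ => ?_
          rw [Finset.sum_ite_eq' Finset.univ, if_pos (Finset.mem_univ _),
            hW (diagonalTerm σ) π]
      _ = _ := by
          simp only [Finset.sum_const, Finset.card_univ, nsmul_eq_mul]
          rw [← Finset.mul_sum]
          rfl
  -- For the product of diagonal entries only `σ = 1` contributes, so no cancellation can occur.
  have hone : 0 < W (diagonalTerm fun _ => 1) := by
    refine Finset.sum_pos' (fun σ _ => ?_) ⟨fun _ => 1, Finset.mem_univ _, ?_⟩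
    · by_cases hσ : σ = fun _ => 1
      · subst hσ
        refine mul_nonneg (by simp [signProd]) (Finset.sum_nonneg fun π _ => ?_)
        split_ifs <;> norm_num
      · rw [Finset.sum_eq_zero, mul_zero]
        intro π _
        rw [if_neg]
        intro h
        apply hσ
        funext i
        ext j
        have h' := h (π.symm (i, j))
        rw [Equiv.apply_symm_apply, diagonalTerm, diagonalTerm, Prod.mk.injEq] at h'
        have h'' := h'.2
        rw [h'.1] at h''
        exact congrArg Fin.val h''.symm
    · refine mul_pos (by simp [signProd]) (Finset.sum_pos' (fun π _ => ?_)
        ⟨1, Finset.mem_univ _, by simp⟩)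
      split_ifs <;> norm_num
  have hpos : 0 < ∑ y, W y ^ 2 :=
    Finset.sum_pos' (fun y _ => sq_nonneg _) ⟨_, Finset.mem_univ _, pow_pos hone 2⟩
  rw [hsq] at hpos
  exact pos_of_mul_pos_right hpos (by positivity)

end Cayley

/-! ### The first fundamental theorem for matrix semi-invariants -/

section Semiinvariants

variable {F : Type*} [Field F] {n m : ℕ}

/-- Evaluation of a polynomial at an `m`-tuple of matrices. -/
noncomputable def matEval (x : Fin m → Matrix (Fin n) (Fin n) F) :
    MvPolynomial (Fin m × Fin n × Fin n) F →ₐ[F] F :=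
  MvPolynomial.aeval fun p => x p.1 p.2.1 p.2.2

theorem matEval_ext [Infinite F] {f g : MvPolynomial (Fin m × Fin n × Fin n) F}
    (h : ∀ x : Fin m → Matrix (Fin n) (Fin n) F, matEval x f = matEval x g) : f = g :=
  MvPolynomial.funext fun x => h fun k => Matrix.of fun i j => x (k, i, j)

theorem map_genericMatrix_matEval (x : Fin m → Matrix (Fin n) (Fin n) F) (k : Fin m) :
    (genericMatrix F n m k).map (matEval x) = x k := by
  ext i j
  simp [genericMatrix, matEval]

theorem matEval_substMatrices (A B : Matrix (Fin n) (Fin n) F)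
    (x : Fin m → Matrix (Fin n) (Fin n) F) (f : MvPolynomial (Fin m × Fin n × Fin n) F) :
    matEval x (substMatrices m A B f) = matEval (fun k => A * x k * B) f := by
  have h : (matEval x).comp (substMatrices m A B) = matEval fun k => A * x k * B := by
    ext p
    simp [matEval, substMatrices, Matrix.mul_apply, genericMatrix]
  exact DFunLike.congr_fun h f

theorem mem_semiInvariants_iff [Infinite F] {f : MvPolynomial (Fin m × Fin n × Fin n) F} :
    f ∈ semiInvariants F n m ↔ ∀ A B : Matrix (Fin n) (Fin n) F, A.det = 1 → B.det = 1 →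
      ∀ x : Fin m → Matrix (Fin n) (Fin n) F, matEval (fun k => A * x k * B) f = matEval x f := by
  simp only [semiInvariants, Algebra.mem_iInf, AlgHom.mem_equalizer, AlgHom.id_apply]
  constructor
  · intro h A B hA hB x
    obtain ⟨B', rfl⟩ : ∃ B' : Matrix.SpecialLinearGroup (Fin n) F,
        (B' : Matrix (Fin n) (Fin n) F) = B := ⟨⟨B, hB⟩, rfl⟩
    have h1 := h (⟨A, hA⟩, B'⁻¹)
    rw [show ((⟨A, hA⟩, B'⁻¹) : Matrix.SpecialLinearGroup (Fin n) F ×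
      Matrix.SpecialLinearGroup (Fin n) F).2⁻¹ = B' from inv_inv B'] at h1
    rw [← matEval_substMatrices, h1]
  · intro h p
    refine matEval_ext fun x => ?_
    rw [matEval_substMatrices]
    exact h _ _ p.1.2 (p.2⁻¹).2 x

theorem matEval_smul {f : MvPolynomial (Fin m × Fin n × Fin n) F} {N : ℕ}
    (hf : f.IsHomogeneous N) (c : F) (x : Fin m → Matrix (Fin n) (Fin n) F) :
    matEval (fun k => c • x k) f = c ^ N * matEval x f := by
  simp only [matEval, MvPolynomial.aeval_def, MvPolynomial.eval₂_eq, Finset.mul_sum]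
  refine Finset.sum_congr rfl fun e he => ?_
  rw [mul_left_comm, hf.degree_eq_sum_deg_support he, ← Finset.prod_pow_eq_pow_sum,
    ← Finset.prod_mul_distrib]
  simp only [Matrix.smul_apply, smul_eq_mul, mul_pow]

theorem substMatrices_isHomogeneous (A B : Matrix (Fin n) (Fin n) F)
    {f : MvPolynomial (Fin m × Fin n × Fin n) F} {N : ℕ} (hf : f.IsHomogeneous N) :
    (substMatrices m A B f).IsHomogeneous N := by
  have h := hf.aeval (n := 1) (fun x : Fin m × Fin n × Fin n =>
    (A.map (MvPolynomial.C (R := F)) * genericMatrix F n m x.1 *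
      B.map (MvPolynomial.C (R := F)) :
        Matrix (Fin n) (Fin n) (MvPolynomial (Fin m × Fin n × Fin n) F)) x.2.1 x.2.2) fun x => by
    simp only [Matrix.mul_apply, Matrix.map_apply, genericMatrix, Matrix.of_apply]
    refine MvPolynomial.IsHomogeneous.sum _ _ _ fun i _ => ?_
    rw [mul_comm]
    refine MvPolynomial.IsHomogeneous.C_mul (MvPolynomial.IsHomogeneous.sum _ _ _ fun j _ => ?_) _
    exact MvPolynomial.isHomogeneous_C_mul_X _ _
  rwa [one_mul] at h

/-- Linear substitution preserves degree, so it commutes with taking homogeneous components. -/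
theorem homogeneousComponent_mem_semiInvariants
    {f : MvPolynomial (Fin m × Fin n × Fin n) F} (hf : f ∈ semiInvariants F n m) (N : ℕ) :
    MvPolynomial.homogeneousComponent N f ∈ semiInvariants F n m := by
  simp only [semiInvariants, Algebra.mem_iInf, AlgHom.mem_equalizer, AlgHom.id_apply] at hf ⊢
  intro p
  by_cases hN : N ∈ Finset.range (f.totalDegree + 1)
  · have h := congrArg (MvPolynomial.homogeneousComponent N) (hf p)
    nth_rewrite 1 [← MvPolynomial.sum_homogeneousComponent f] at h
    rw [map_sum, map_sum] at h
    refine Eq.trans ?_ h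
    rw [Finset.sum_eq_single_of_mem N hN]
    · rw [MvPolynomial.homogeneousComponent_of_mem (substMatrices_isHomogeneous _ _
        (MvPolynomial.homogeneousComponent_isHomogeneous N f)), if_pos rfl]
    · intro i _ hi
      rw [MvPolynomial.homogeneousComponent_of_mem (substMatrices_isHomogeneous _ _
        (MvPolynomial.homogeneousComponent_isHomogeneous i f)), if_neg hi.symm]
  · rw [Finset.mem_range] at hN
    rw [MvPolynomial.homogeneousComponent_eq_zero N f (by omega), map_zero]

/-- Semi-invariants are relative invariants of the general linear group. -/
theorem exists_matEval_mul_left [CharZero F] (hn : 1 ≤ n)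
    {f : MvPolynomial (Fin m × Fin n × Fin n) F} (hf : f ∈ semiInvariants F n m) {N : ℕ}
    (hN : f.IsHomogeneous N) (hf0 : f ≠ 0) :
    ∃ d, N = d * n ∧ ∀ (A : Matrix (Fin n) (Fin n) F) (x : Fin m → Matrix (Fin n) (Fin n) F),
      A.det ≠ 0 → matEval (fun k => A * x k) f = A.det ^ d * matEval x f := by
  -- `Δ t = diag(t, 1, …, 1)`. As `A * Δ (det A)⁻¹` has determinant 1, invariance reduces the action
  -- of `A` to that of `Δ (det A)`.
  let Δ : F → Matrix (Fin n) (Fin n) F := fun t => Matrix.diagonal (Pi.mulSingle ⟨0, hn⟩ t)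
  have hΔ : ∀ t, (Δ t).det = t := fun t => by
    rw [Matrix.det_diagonal, Finset.prod_pi_mulSingle']
    simp
  have hinv := mem_semiInvariants_iff.1 hf
  have hdet : ∀ (A : Matrix (Fin n) (Fin n) F) (x : Fin m → Matrix (Fin n) (Fin n) F),
      A.det ≠ 0 → matEval (fun k => A * x k) f = matEval (fun k => Δ A.det * x k) f := by
    intro A x hA
    have h := hinv (A * Δ (A.det)⁻¹) 1 (by rw [Matrix.det_mul, hΔ, mul_inv_cancel₀ hA])
      Matrix.det_one fun k => Δ A.det * x k
    rw [← h]
    congr 2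
    funext k
    have e : Δ (A.det)⁻¹ * Δ A.det = 1 := by
      simp only [Δ]
      rw [Matrix.diagonal_mul_diagonal, ← Matrix.diagonal_one]
      congr 1
      funext i
      rw [← Pi.mul_apply, ← Pi.mulSingle_mul, inv_mul_cancel₀ hA, Pi.mulSingle_one, Pi.one_apply]
    rw [Matrix.mul_one, Matrix.mul_assoc, ← Matrix.mul_assoc (Δ _) (Δ _), e, Matrix.one_mul]
  have hpoly : ∀ x : Fin m → Matrix (Fin n) (Fin n) F, ∃ h : Polynomial F,
      ∀ t, h.eval t = matEval (fun k => Δ t * x k) f := by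
    intro x
    refine ⟨MvPolynomial.aeval (fun p : Fin m × Fin n × Fin n =>
      (Pi.mulSingle ⟨0, hn⟩ Polynomial.X : Fin n → Polynomial F) p.2.1 *
        Polynomial.C (x p.1 p.2.1 p.2.2)) f, fun t => ?_⟩
    have : (Polynomial.aeval t).comp (MvPolynomial.aeval (fun p : Fin m × Fin n × Fin n =>
      (Pi.mulSingle ⟨0, hn⟩ Polynomial.X : Fin n → Polynomial F) p.2.1 *
        Polynomial.C (x p.1 p.2.1 p.2.2))) = matEval fun k => Δ t * x k := by
      ext p
      simp only [matEval, AlgHom.comp_apply, MvPolynomial.aeval_X, Δ, Matrix.diagonal_mul, map_mul,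
        Polynomial.aeval_C, Pi.mulSingle_apply]
      split_ifs <;> simp
    rw [← this, AlgHom.comp_apply, Polynomial.coe_aeval_eq_eval]
  choose h hh using hpoly
  -- Taking `A = c • 1`, of determinant `c ^ n`, and using homogeneity gives `h x (c ^ n) = c ^ N *
  -- f(x)` for all `c ≠ 0`.
  have hexp : ∀ x, Polynomial.expand F n (h x) =
      Polynomial.C (matEval x f) * Polynomial.X ^ N := by
    intro x
    refine Polynomial.eq_of_infinite_eval_eq _ _
      (Set.Infinite.mono (s := {0}ᶜ) (fun c hc => ?_) (Set.finite_singleton 0).infinite_compl)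
    have hc' : (c • (1 : Matrix (Fin n) (Fin n) F)).det = c ^ n := by
      rw [Matrix.det_smul, Matrix.det_one, mul_one, Fintype.card_fin]
    have h1 := hdet (c • 1) x (by rw [hc']; exact pow_ne_zero _ hc)
    rw [hc', ← hh] at h1
    simp only [Matrix.smul_mul, Matrix.one_mul] at h1
    rw [matEval_smul hN] at h1
    rw [Set.mem_ofPred_eq, Polynomial.expand_eval, ← h1, Polynomial.eval_mul, Polynomial.eval_C, Polynomial.eval_pow,
      Polynomial.eval_X, mul_comm]
  obtain ⟨x₀, hx₀⟩ : ∃ x : Fin m → Matrix (Fin n) (Fin n) F, matEval x f ≠ 0 := by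
    by_contra! hcon
    exact hf0 (matEval_ext fun x => by rw [hcon x, map_zero])
  -- Comparing degrees in `hexp` at a point where `f` does not vanish shows that `n` divides `N`.
  have hdeg : N = (h x₀).natDegree * n := by
    have := congrArg Polynomial.natDegree (hexp x₀)
    rwa [Polynomial.natDegree_expand, Polynomial.natDegree_C_mul_X_pow _ _ hx₀, eq_comm] at this
  refine ⟨(h x₀).natDegree, hdeg, fun A x hA => ?_⟩
  have hx : h x = Polynomial.C (matEval x f) * Polynomial.X ^ (h x₀).natDegree := by
    refine Polynomial.expand_injective (by omega : 0 < n) ?_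
    rw [hexp, map_mul, map_pow, Polynomial.expand_C, Polynomial.expand_X, ← pow_mul, mul_comm n,
      ← hdeg]
  rw [hdet A x hA, ← hh, hx, Polynomial.eval_mul, Polynomial.eval_C, Polynomial.eval_pow,
    Polynomial.eval_X, mul_comm]

/-- The generic substitution `f(X_1, …, X_m) ↦ f(A X_1, …, A X_m)`. -/
noncomputable def genericLeft (F : Type*) [Field F] (n m : ℕ) :
    MvPolynomial (Fin m × Fin n × Fin n) F →ₐ[F]
      MvPolynomial (Fin n × Fin n) (MvPolynomial (Fin m × Fin n × Fin n) F) :=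
  MvPolynomial.aeval fun p =>
    ∑ s, MvPolynomial.X (p.2.1, s) * MvPolynomial.C (MvPolynomial.X (p.1, s, p.2.2))

theorem eval_map_genericLeft (A : Matrix (Fin n) (Fin n) F)
    (x : Fin m → Matrix (Fin n) (Fin n) F) (f : MvPolynomial (Fin m × Fin n × Fin n) F) :
    MvPolynomial.eval (fun p => A p.1 p.2)
      (MvPolynomial.map (matEval x : _ →+* F) (genericLeft F n m f)) =
        matEval (fun k => A * x k) f := by
  induction f using MvPolynomial.induction_on with
  | C a => simp [genericLeft, matEval]
  | add p q hp hq => simp only [map_add, hp, hq]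
  | mul_X p i hp =>
    rw [map_mul, map_mul, map_mul, hp, map_mul]
    congr 1
    simp [genericLeft, matEval, Matrix.mul_apply]

theorem genericLeft_eq [CharZero F] (hn : 1 ≤ n)
    {f : MvPolynomial (Fin m × Fin n × Fin n) F} (hf : f ∈ semiInvariants F n m) {N : ℕ}
    (hN : f.IsHomogeneous N) (hf0 : f ≠ 0) :
    ∃ d, N = d * n ∧ genericLeft F n m f =
      (Matrix.of fun i j => MvPolynomial.X (i, j)).det ^ d * MvPolynomial.C f := by
  obtain ⟨d, hd, h⟩ := exists_matEval_mul_left hn hf hN hf0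
  refine ⟨d, hd, ?_⟩
  -- The transformation law is known only for invertible `A`. With an extra factor `det` both sides
  -- vanish at singular `A`, so the identity can be checked at every point.
  refine mul_left_cancel₀ (Matrix.det_mvPolynomialX_ne_zero (Fin n)
    (MvPolynomial (Fin m × Fin n × Fin n) F)) ?_
  refine MvPolynomial.ext _ _ fun e => matEval_ext fun x => ?_
  suffices hx : ∀ A : Matrix (Fin n) (Fin n) F, MvPolynomial.eval (fun p => A p.1 p.2)
      (MvPolynomial.map (matEval x : _ →+* F)
        ((Matrix.mvPolynomialX (Fin n) (Fin n) _).det * genericLeft F n m f)) =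
      MvPolynomial.eval (fun p => A p.1 p.2) (MvPolynomial.map (matEval x : _ →+* F)
        ((Matrix.mvPolynomialX (Fin n) (Fin n) _).det *
          ((Matrix.of fun i j => MvPolynomial.X (i, j)).det ^ d * MvPolynomial.C f))) by
    have := MvPolynomial.funext fun a => hx (Matrix.of fun i j => a (i, j))
    have := congrArg (MvPolynomial.coeff e) this
    rwa [MvPolynomial.coeff_map, MvPolynomial.coeff_map] at this
  intro A
  have hA : MvPolynomial.eval (fun p => A p.1 p.2) (MvPolynomial.map (matEval x : _ →+* F)
      (Matrix.mvPolynomialX (Fin n) (Fin n) (MvPolynomial (Fin m × Fin n × Fin n) F)).det) =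
        A.det := by
    rw [RingHom.map_det, RingHom.map_det]
    congr 1
    ext i j
    simp
  have hA' : MvPolynomial.eval (fun p => A p.1 p.2) (MvPolynomial.map (matEval x : _ →+* F)
      (Matrix.of fun i j => (MvPolynomial.X (i, j) : MvPolynomial (Fin n × Fin n)
        (MvPolynomial (Fin m × Fin n × Fin n) F))).det) = A.det := hA
  simp only [map_mul, map_pow, hA, hA', eval_map_genericLeft, MvPolynomial.map_C,
    MvPolynomial.eval_C]
  by_cases h0 : A.det = 0
  · simp [h0]
  · rw [h A x h0]
    rfl

end Semiinvariants

/-! ### Semi-invariants of pairs of fillings, and Cayley's operator on both sides. -/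

section FirstFundamentalTheorem

variable {F : Type*} [Field F] {n m : ℕ}

/-- The semi-invariant attached to a pair of fillings and a choice of matrices. -/
noncomputable def pairInvariant (F : Type*) [Field F] {n m : ℕ} {ι D D' : Type*} [Fintype ι]
    [Fintype D] [DecidableEq D] [Fintype D'] [DecidableEq D'] (S : ι ≃ D × Fin n)
    (T : ι ≃ D' × Fin n) (κ : ι → Fin m) : MvPolynomial (Fin m × Fin n × Fin n) F :=
  doubleDet S T fun k => genericMatrix F n m (κ k)

section

variable {ι D D' : Type*} [Fintype ι] [Fintype D] [DecidableEq D] [Fintype D'] [DecidableEq D']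
  (S : ι ≃ D × Fin n) (T : ι ≃ D' × Fin n) (κ : ι → Fin m)

theorem matEval_pairInvariant (x : Fin m → Matrix (Fin n) (Fin n) F) :
    matEval x (pairInvariant F S T κ) = doubleDet S T fun k => x (κ k) := by
  rw [pairInvariant]
  refine (map_doubleDet (matEval x).toRingHom S T _).trans ?_
  congr 1
  funext k
  exact map_genericMatrix_matEval x (κ k)

theorem pairInvariant_mem [CharZero F] : pairInvariant F S T κ ∈ semiInvariants F n m := by
  rw [mem_semiInvariants_iff]
  intro A B hA hB x
  rw [matEval_pairInvariant, matEval_pairInvariant,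
    doubleDet_mul_right S T B fun k => A * x (κ k), doubleDet_mul_left, hA, hB]
  simp

theorem pairInvariant_isHomogeneous :
    (pairInvariant F S T κ).IsHomogeneous (Fintype.card ι) := by
  refine MvPolynomial.IsHomogeneous.sum _ _ _ fun σ _ => ?_
  refine MvPolynomial.IsHomogeneous.sum _ _ _ fun τ _ => ?_
  rw [← map_signProd (MvPolynomial.C (R := F)) σ, ← map_signProd (MvPolynomial.C (R := F)) τ,
    ← map_mul]
  refine MvPolynomial.IsHomogeneous.C_mul ?_ _
  rw [Fintype.card, Finset.card_eq_sum_ones]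
  exact MvPolynomial.IsHomogeneous.prod _ _ _ fun k _ => MvPolynomial.isHomogeneous_X _ _

end

/-- Transposition of all matrices. -/
noncomputable def transposeHom (F : Type*) [Field F] (n m : ℕ) :
    MvPolynomial (Fin m × Fin n × Fin n) F →ₐ[F] MvPolynomial (Fin m × Fin n × Fin n) F :=
  MvPolynomial.rename fun p => (p.1, p.2.2, p.2.1)

theorem transposeHom_X (p : Fin m × Fin n × Fin n) :
    transposeHom F n m (MvPolynomial.X p) = MvPolynomial.X (p.1, p.2.2, p.2.1) :=
  MvPolynomial.rename_X _ _

theorem transposeHom_transposeHom (f : MvPolynomial (Fin m × Fin n × Fin n) F) :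
    transposeHom F n m (transposeHom F n m f) = f := by
  have h : (transposeHom F n m).comp (transposeHom F n m) = AlgHom.id F _ := by
    ext p
    simp [transposeHom_X]
  exact DFunLike.congr_fun h f

theorem matEval_transposeHom (x : Fin m → Matrix (Fin n) (Fin n) F)
    (f : MvPolynomial (Fin m × Fin n × Fin n) F) :
    matEval x (transposeHom F n m f) = matEval (fun k => (x k).transpose) f := by
  have h : (matEval x).comp (transposeHom F n m) = matEval fun k => (x k).transpose := by
    ext p
    simp [matEval, transposeHom_X]
  exact DFunLike.congr_fun h f

theorem transposeHom_mem [CharZero F] {f : MvPolynomial (Fin m × Fin n × Fin n) F}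
    (hf : f ∈ semiInvariants F n m) : transposeHom F n m f ∈ semiInvariants F n m := by
  rw [mem_semiInvariants_iff] at hf ⊢
  intro A B hA hB x
  rw [matEval_transposeHom, matEval_transposeHom]
  have := hf B.transpose A.transpose (by rwa [Matrix.det_transpose])
    (by rwa [Matrix.det_transpose]) fun k => (x k).transpose
  rw [← this]
  simp only [Matrix.transpose_mul, Matrix.mul_assoc]

/-- Cayley's operator, applied to the generic substitution on the left. -/
noncomputable def cayleyLeft (F : Type*) [Field F] (n m d : ℕ) :
    MvPolynomial (Fin m × Fin n × Fin n) F →ₗ[F] MvPolynomial (Fin m × Fin n × Fin n) F :=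
  (cayley (MvPolynomial (Fin m × Fin n × Fin n) F) n d).restrictScalars F ∘ₗ
    (genericLeft F n m).toLinearMap

/-- The bijections `π` that match the factors with the cells of the `d × n` grid come from
polarization; they will serve as fillings. -/
theorem cayleyLeft_prod_X (d : ℕ) {ι : Type*} [Fintype ι] [DecidableEq ι] (κ : ι → Fin m)
    (a b : ι → Fin n) :
    cayleyLeft F n m d (∏ k, MvPolynomial.X (κ k, a k, b k)) =
      ∑ π : ι ≃ Fin d × Fin n, if ∀ k, a k = (π k).2 then
        ∑ σ : Fin d → Equiv.Perm (Fin n), signProd F σ •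
          ∏ k, MvPolynomial.X (κ k, σ (π k).1 (π k).2, b k) else 0 := by
  simp only [cayleyLeft, LinearMap.comp_apply, LinearMap.restrictScalars_apply,
    AlgHom.toLinearMap_apply, map_prod, genericLeft, MvPolynomial.aeval_X]
  rw [cayley_prod a fun k s => MvPolynomial.X (κ k, s, b k)]
  simp only [MvPolynomial.smul_eq_C_mul, map_signProd MvPolynomial.C]

/-- Cayley's operator, applied to the generic substitution on the right. -/
noncomputable def cayleyRight (F : Type*) [Field F] (n m d : ℕ) :
    MvPolynomial (Fin m × Fin n × Fin n) F →ₗ[F] MvPolynomial (Fin m × Fin n × Fin n) F :=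
  (transposeHom F n m).toLinearMap ∘ₗ cayleyLeft F n m d ∘ₗ (transposeHom F n m).toLinearMap

theorem cayleyRight_prod_X (d : ℕ) {ι : Type*} [Fintype ι] [DecidableEq ι] (κ : ι → Fin m)
    (a b : ι → Fin n) :
    cayleyRight F n m d (∏ k, MvPolynomial.X (κ k, a k, b k)) =
      ∑ π : ι ≃ Fin d × Fin n, if ∀ k, b k = (π k).2 then
        ∑ τ : Fin d → Equiv.Perm (Fin n), signProd F τ •
          ∏ k, MvPolynomial.X (κ k, a k, τ (π k).1 (π k).2) else 0 := by
  simp only [cayleyRight, LinearMap.comp_apply, AlgHom.toLinearMap_apply, map_prod,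
    transposeHom_X, cayleyLeft_prod_X, map_sum, apply_ite (transposeHom F n m), map_smul,
    map_zero]

/-- After the generic substitution `f` becomes `det ^ d` times the constant `f`, and the operator
acts on `det ^ d` alone. -/
theorem cayleyLeft_eq [CharZero F] (hn : 1 ≤ n)
    {f : MvPolynomial (Fin m × Fin n × Fin n) F} (hf : f ∈ semiInvariants F n m) {d : ℕ}
    (hN : f.IsHomogeneous (d * n)) : cayleyLeft F n m d f = (cayleyConstant n d : F) • f := by
  by_cases hf0 : f = 0
  · rw [hf0, map_zero, smul_zero]
  obtain ⟨d', hd', h⟩ := genericLeft_eq hn hf hN hf0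
  obtain rfl := Nat.eq_of_mul_eq_mul_right hn hd'
  simp only [cayleyLeft, LinearMap.comp_apply, LinearMap.restrictScalars_apply,
    AlgHom.toLinearMap_apply, h]
  rw [mul_comm, ← MvPolynomial.smul_eq_C_mul, map_smul, cayley_det_pow, smul_eq_mul, mul_comm,
    MvPolynomial.smul_eq_C_mul, map_intCast]

theorem cayleyRight_eq [CharZero F] (hn : 1 ≤ n)
    {f : MvPolynomial (Fin m × Fin n × Fin n) F} (hf : f ∈ semiInvariants F n m) {d : ℕ}
    (hN : f.IsHomogeneous (d * n)) : cayleyRight F n m d f = (cayleyConstant n d : F) • f := by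
  simp only [cayleyRight, LinearMap.comp_apply, AlgHom.toLinearMap_apply]
  rw [cayleyLeft_eq hn (transposeHom_mem hf) hN.rename_isHomogeneous, map_smul,
    transposeHom_transposeHom]

theorem exists_monomial_eq_prod_X {σ R : Type*} [CommSemiring R] (e : σ →₀ ℕ) :
    ∃ g : Fin e.degree → σ, MvPolynomial.monomial e (1 : R) = ∏ k, MvPolynomial.X (g k) := by
  have hlen : e.toMultiset.toList.length = e.degree := by
    rw [Multiset.length_toList, Finsupp.card_toMultiset]
    rfl
  refine ⟨fun k => e.toMultiset.toList.get (k.cast hlen.symm), ?_⟩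
  have h1 : MvPolynomial.monomial e (1 : R) = (e.toMultiset.map MvPolynomial.X).prod := by
    rw [MvPolynomial.monomial_eq, Finsupp.toMultiset_map, Finsupp.prod_toMultiset,
      Finsupp.prod_mapDomain_index pow_zero pow_add, map_one, one_mul]
  rw [h1]
  conv_lhs => rw [← Multiset.coe_toList e.toMultiset]
  rw [Multiset.map_coe, Multiset.prod_coe, ← (finCongr hlen).prod_comp, ← List.prod_ofFn]
  congr 1
  apply List.ext_get <;> simp

/-- The span of the semi-invariants attached to pairs of fillings by `d` rows. -/
noncomputable def pairSpan (F : Type*) [Field F] (n m d : ℕ) :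
    Submodule F (MvPolynomial (Fin m × Fin n × Fin n) F) :=
  Submodule.span F {g | ∃ (S T : Fin (d * n) ≃ Fin d × Fin n) (κ : Fin (d * n) → Fin m),
    g = pairInvariant F S T κ}

/-- Invariance of `f` plays no role: on each monomial the bijection from the left operator becomes
`S`, the one from the right operator becomes `T`, and the two signed sums form `doubleDet S T`. -/
theorem cayleyRight_cayleyLeft_mem {d : ℕ} {f : MvPolynomial (Fin m × Fin n × Fin n) F}
    (hN : f.IsHomogeneous (d * n)) :
    cayleyRight F n m d (cayleyLeft F n m d f) ∈ pairSpan F n m d := by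
  rw [f.as_sum, map_sum, map_sum]
  refine Submodule.sum_mem _ fun e he => ?_
  have hdeg : e.degree = d * n := (hN.degree_eq_sum_deg_support he).symm
  obtain ⟨g, hg⟩ : ∃ g : Fin (d * n) → Fin m × Fin n × Fin n,
      MvPolynomial.monomial e (1 : F) = ∏ k, MvPolynomial.X (g k) := by
    rw [← hdeg]
    exact exists_monomial_eq_prod_X e
  rw [← mul_one (MvPolynomial.coeff e f), ← smul_eq_mul, ← MvPolynomial.smul_monomial, map_smul,
    map_smul, hg]
  refine Submodule.smul_mem _ _ ?_
  rw [cayleyLeft_prod_X d (fun k => (g k).1) (fun k => (g k).2.1) (fun k => (g k).2.2), map_sum]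
  refine Submodule.sum_mem _ fun S _ => ?_
  split_ifs
  swap
  · rw [map_zero]
    exact zero_mem _
  simp only [map_sum, map_smul, cayleyRight_prod_X, Finset.smul_sum]
  rw [Finset.sum_comm]
  refine Submodule.sum_mem _ fun T _ => ?_
  split_ifs
  swap
  · simp
  refine Submodule.subset_span ⟨S, T, fun k => (g k).1, ?_⟩
  rw [pairInvariant, doubleDet]
  refine Finset.sum_congr rfl fun σ _ => ?_
  rw [Finset.smul_sum]
  refine Finset.sum_congr rfl fun τ _ => ?_
  rw [smul_smul, MvPolynomial.smul_eq_C_mul, map_mul, map_signProd MvPolynomial.C,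
    map_signProd MvPolynomial.C]
  simp only [genericMatrix, Matrix.of_apply]

/-- The first fundamental theorem for matrix semi-invariants. -/
theorem mem_pairSpan [CharZero F] (hn : 1 ≤ n)
    {f : MvPolynomial (Fin m × Fin n × Fin n) F} (hf : f ∈ semiInvariants F n m) {d : ℕ}
    (hN : f.IsHomogeneous (d * n)) : f ∈ pairSpan F n m d := by
  -- The two operators together multiply `f` by the square of this constant, which is invertible in
  -- characteristic zero.
  have hK : (cayleyConstant n d : F) ≠ 0 := Int.cast_ne_zero.2 (cayleyConstant_pos n d).ne'
  have h := cayleyRight_cayleyLeft_mem hN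
  rw [cayleyLeft_eq hn hf hN, map_smul, cayleyRight_eq hn hf hN] at h
  exact ((pairSpan F n m d).smul_mem_iff hK).1 (((pairSpan F n m d).smul_mem_iff hK).1 h)

end FirstFundamentalTheorem

/-! ### Coordinates of `φ` -/

section Coordinates

variable {F : Type*} [Field F] {n d : ℕ}

/-- The coordinates of the multilinear function attached to a pair of fillings. -/
def pairTensor (F : Type*) [Field F] {n : ℕ} {ι D D' : Type*} [Fintype ι]
    [Fintype D] [DecidableEq D] [Fintype D'] [DecidableEq D'] (S : ι ≃ D × Fin n)
    (T : ι ≃ D' × Fin n) (s : ι → Fin n × Fin n) : F :=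
  doubleDet S T fun k => Matrix.single (s k).1 (s k).2 (1 : F)

/-- The filling recorded by a repetition-free tableau. -/
noncomputable def tableauFilling (T : Fin d → Fin n → Fin (d * n)) (hT : RepetitionFree T) :
    Fin (d * n) ≃ Fin d × Fin n :=
  (Equiv.ofBijective (fun p : Fin d × Fin n => T p.1 p.2) (by
    have hs : Function.Surjective fun p : Fin d × Fin n => T p.1 p.2 := fun k => by
      obtain ⟨i, j, h⟩ := hT k
      exact ⟨(i, j), h⟩
    exact ⟨hs.injective_of_finite finProdFinEquiv, hs⟩)).symm

theorem tableauFilling_symm_apply (T : Fin d → Fin n → Fin (d * n)) (hT : RepetitionFree T)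
    (p : Fin d × Fin n) : (tableauFilling T hT).symm p = T p.1 p.2 :=
  rfl

theorem exists_tableauFilling_eq (S : Fin (d * n) ≃ Fin d × Fin n) :
    ∃ (T : Fin d → Fin n → Fin (d * n)) (hT : RepetitionFree T), tableauFilling T hT = S := by
  have hT : RepetitionFree fun i j => S.symm (i, j) := fun k => ⟨(S k).1, (S k).2, by simp⟩
  refine ⟨fun i j => S.symm (i, j), hT, Equiv.symm_bijective.injective (Equiv.ext fun p => ?_)⟩
  rw [tableauFilling_symm_apply]

/-- The coordinates of a multilinear function with respect to the standard basis of
`F^n ⊗ F^n`. -/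
noncomputable def tensorCoordinates (F : Type*) [Field F] (n N : ℕ) :
    MultilinearMap F (fun _ : Fin N => (Fin n → F) ⊗[F] (Fin n → F)) F →ₗ[F]
      ((Fin N → Fin n × Fin n) → F) where
  toFun g s := g fun k => Pi.single (s k).1 1 ⊗ₜ Pi.single (s k).2 1
  map_add' _ _ := rfl
  map_smul' _ _ := rfl

theorem tensorCoordinates_injective (F : Type*) [Field F] (n N : ℕ) :
    Function.Injective (tensorCoordinates F n N) := by
  intro f g h
  refine Module.Basis.ext_multilinear
    (fun _ => (Pi.basisFun F (Fin n)).tensorProduct (Pi.basisFun F (Fin n))) fun s => ?_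
  simpa [Module.Basis.tensorProduct_apply', tensorCoordinates] using congrFun h s

/-- The map `φ` in coordinates. -/
noncomputable def phiCoordinates (F : Type*) [Field F] (n d : ℕ) :
    multiBrackets F n d ⊗[F] multiBrackets F n d →ₗ[F]
      ((Fin (d * n) → Fin n × Fin n) → F) :=
  tensorCoordinates F n (d * n) ∘ₗ phi F n d

/-- A matrix unit is a product of two unit vectors, so the value of `φ` at a tensor of basis vectors
is `doubleDet` at matrix units. -/
theorem phiCoordinates_tmul (S T : Fin d → Fin n → Fin (d * n)) (hS : RepetitionFree S)
    (hT : RepetitionFree T) :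
    phiCoordinates F n d (multiMonomial F S hS ⊗ₜ multiMonomial F T hT) =
      pairTensor F (tableauFilling S hS) (tableauFilling T hT) := by
  funext s
  refine (phi_tmul_apply S T hS hT (fun k => Pi.single (s k).1 1)
    fun k => Pi.single (s k).2 1).trans ?_
  have h : ∀ k, Matrix.single (s k).1 (s k).2 (1 : F) =
      Matrix.vecMulVec (Pi.single (s k).1 1) (Pi.single (s k).2 1) := fun k => by
    rw [← Matrix.single_eq_single_vecMulVec_single]
  simp only [pairTensor, h]
  rw [doubleDet_vecMulVec]
  rfl

theorem ker_phiCoordinates : LinearMap.ker (phiCoordinates F n d) = LinearMap.ker (phi F n d) :=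
  LinearMap.ker_comp_of_ker_eq_bot _
    (LinearMap.ker_eq_bot.2 (tensorCoordinates_injective F n (d * n)))

theorem span_multiMonomial_tmul :
    Submodule.span F {z : multiBrackets F n d ⊗[F] multiBrackets F n d |
      ∃ S T hS hT, z = multiMonomial F S hS ⊗ₜ multiMonomial F T hT} = ⊤ := by
  have h : Submodule.span F {x : multiBrackets F n d | ∃ T hT, x = multiMonomial F T hT} = ⊤ := by
    rw [eq_top_iff]
    refine le_trans (Submodule.span_span_coe_preimage (R := F)
      (s := {x | ∃ T : Fin d → Fin n → Fin (d * n),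
        RepetitionFree T ∧ x = bracketMonomial F T})).ge ?_
    refine Submodule.span_mono ?_
    rintro x ⟨T, hT, hx⟩
    exact ⟨T, hT, Subtype.ext hx⟩
  rw [eq_top_iff, ← TensorProduct.map₂_mk_top_top_eq_top, ← h, Submodule.map₂_span_span]
  refine Submodule.span_mono ?_
  rintro _ ⟨_, ⟨S, hS, rfl⟩, _, ⟨T, hT, rfl⟩, rfl⟩
  exact ⟨S, T, hS, hT, rfl⟩

end Coordinates

/-! ### Connectedness of correlated tableaux -/

namespace CorrelatedTableau

variable {n d : ℕ}

/-- The filling given by the rows of a correlated tableau. -/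
noncomputable def rowFilling (C : CorrelatedTableau n d) : Fin (d * n) ≃ Fin d × Fin n :=
  tableauFilling C.rowReading C.repetitionFree_rowReading

/-- The filling given by the columns of a correlated tableau. -/
noncomputable def colFilling (C : CorrelatedTableau n d) : Fin (d * n) ≃ Fin d × Fin n :=
  tableauFilling C.colReading C.repetitionFree_colReading

theorem exists_mem_cell_rowFilling (C : CorrelatedTableau n d) (k : Fin (d * n)) :
    ∃ j, k ∈ C.cell (C.rowFilling k).1 j := by
  have h : C.rowReading (C.rowFilling k).1 (C.rowFilling k).2 = k :=
    C.rowFilling.symm_apply_apply k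
  have hk : k ∈ C.rowWord (C.rowFilling k).1 := by
    rw [← h]
    nth_rewrite 1 [h]
    exact List.get_mem _ _
  simpa [rowWord] using hk

theorem mem_cell_iff (C : CorrelatedTableau n d) (k : Fin (d * n)) (i j : Fin d) :
    k ∈ C.cell i j ↔ (C.rowFilling k).1 = i ∧ (C.colFilling k).1 = j := by
  obtain ⟨j', hj'⟩ := C.exists_mem_cell_rowFilling k
  obtain ⟨i', hi'⟩ := C.transpose.exists_mem_cell_rowFilling k
  have hi'' : k ∈ C.cell i' (C.colFilling k).1 := hi'
  have e := (C.existsUnique_mem k).unique (y₁ := ((C.rowFilling k).1, j'))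
    (y₂ := (i', (C.colFilling k).1)) hj' hi''
  rw [Prod.mk.injEq] at e
  rw [e.2] at hj'
  constructor
  · intro h
    exact Prod.mk.inj ((C.existsUnique_mem k).unique
      (y₁ := ((C.rowFilling k).1, (C.colFilling k).1)) (y₂ := (i, j)) hj' h)
  · rintro ⟨rfl, rfl⟩
    exact hj'

theorem graph_adj_inl_inr (C : CorrelatedTableau n d) (i j : Fin d) :
    C.graph.Adj (Sum.inl i) (Sum.inr j) ↔
      ∃ k, (C.rowFilling k).1 = i ∧ (C.colFilling k).1 = j := by
  simp [graph, Finset.Nonempty, mem_cell_iff, eq_comm]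

theorem not_connected_iff (C : CorrelatedTableau n d) (hn : 1 ≤ n) (hd : 1 ≤ d) :
    ¬C.graph.Connected ↔ DisconnectedPair C.rowFilling C.colFilling := by
  constructor
  · intro h
    have : Nonempty (Fin d ⊕ Fin d) := ⟨Sum.inl ⟨0, hd⟩⟩
    have h' : ¬C.graph.Preconnected := fun hp => h ⟨hp⟩
    simp only [SimpleGraph.Preconnected, not_forall] at h'
    obtain ⟨u, v, huv⟩ := h'
    have hadj : ∀ k, C.graph.Adj (Sum.inl (C.rowFilling k).1) (Sum.inr (C.colFilling k).1) :=
      fun k => (C.graph_adj_inl_inr _ _).2 ⟨k, rfl, rfl⟩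
    -- Since `n ≥ 1`, every column contains an element, so every component meets the left side.
    -- Hence the component of `u` is a nontrivial set of rows.
    have hrow : ∀ w, ∃ i, C.graph.Reachable w (Sum.inl i) := by
      rintro (i | j)
      · exact ⟨i, SimpleGraph.Reachable.refl _⟩
      · have := hadj (C.colFilling.symm (j, ⟨0, hn⟩))
        rw [Equiv.apply_symm_apply] at this
        exact ⟨_, this.symm.reachable⟩
    refine ⟨fun i => C.graph.Reachable u (Sum.inl i), fun j => C.graph.Reachable u (Sum.inr j),
      fun k => ⟨fun hk => hk.trans (hadj k).reachable,
        fun hk => hk.trans (hadj k).symm.reachable⟩, hrow u, ?_⟩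
    obtain ⟨i, hi⟩ := hrow v
    exact ⟨i, fun hui => huv (hui.trans hi.symm)⟩
  · rintro ⟨P, P', hP, ⟨i, hi⟩, ⟨i', hi'⟩⟩ h
    have key : ∀ u v, C.graph.Adj u v → (Sum.elim P P' u ↔ Sum.elim P P' v) := by
      have hlr : ∀ i j, C.graph.Adj (Sum.inl i) (Sum.inr j) → (P i ↔ P' j) := by
        intro i j hij
        obtain ⟨k, rfl, rfl⟩ := (C.graph_adj_inl_inr i j).1 hij
        exact hP k
      rintro (u | u) (v | v) huv
      · simp [graph] at huv
      · exact hlr u v huv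
      · exact (hlr v u huv.symm).symm
      · simp [graph] at huv
    have hr : ∀ u v, C.graph.Reachable u v → (Sum.elim P P' u ↔ Sum.elim P P' v) := by
      rintro u v ⟨w⟩
      induction w with
      | nil => rfl
      | cons hadj _ ih => exact (key _ _ hadj).trans ih
    exact hi' ((hr _ _ (h.preconnected (Sum.inl i) (Sum.inl i'))).1 hi)

/-- The correlated tableau given by the intersections of the rows of two fillings. -/
def ofFillings (S T : Fin (d * n) ≃ Fin d × Fin n) : CorrelatedTableau n d where
  cell i j := Finset.univ.filter fun k => (S k).1 = i ∧ (T k).1 = j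
  existsUnique_mem k := ⟨((S k).1, (T k).1), by simp, fun p hp => by
    simp only [Finset.mem_filter, Finset.mem_univ, true_and] at hp
    rw [hp.1, hp.2]⟩
  card_row i := by
    refine (Finset.card_bij' (t := Finset.univ (α := Fin n)) (fun k _ => (S k).2)
      (fun j _ => S.symm (i, j)) ?_ ?_ ?_ ?_).trans (by simp)
    · simp
    · simp
    · intro k hk
      simp only [Finset.mem_biUnion, Finset.mem_univ, Finset.mem_filter, true_and,
        exists_and_left] at hk
      rw [← hk.1, Prod.mk.eta, S.symm_apply_apply]
    · simp
  card_col j := by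
    refine (Finset.card_bij' (t := Finset.univ (α := Fin n)) (fun k _ => (T k).2)
      (fun i _ => T.symm (j, i)) ?_ ?_ ?_ ?_).trans (by simp)
    · simp
    · simp
    · intro k hk
      simp only [Finset.mem_biUnion, Finset.mem_univ, Finset.mem_filter, true_and,
        exists_and_right] at hk
      rw [← hk.2, Prod.mk.eta, T.symm_apply_apply]
    · simp

theorem ofFillings_filling (S T : Fin (d * n) ≃ Fin d × Fin n) (k : Fin (d * n)) :
    ((ofFillings S T).rowFilling k).1 = (S k).1 ∧
      ((ofFillings S T).colFilling k).1 = (T k).1 := by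
  rw [← mem_cell_iff]
  simp [ofFillings]

end CorrelatedTableau

/-! ### The spanning condition in terms of coordinates of pairs of fillings. -/

section Translation

variable {F : Type*} [Field F] {n d : ℕ}

/-- The span of the coordinates of the multilinear functions attached to disconnected pairs. -/
def disconnectedTensors (F : Type*) [Field F] (n d : ℕ) :
    Submodule F ((Fin (d * n) → Fin n × Fin n) → F) :=
  Submodule.span F {g | ∃ S T : Fin (d * n) ≃ Fin d × Fin n,
    DisconnectedPair S T ∧ g = pairTensor F S T}

theorem comap_map_eq_sup_ker {E V : Type*} [AddCommMonoid E] [Module F E] [AddCommGroup V]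
    [Module F V] (f : E →ₗ[F] V) (p : Submodule F E) :
    (p.map f).comap f = p ⊔ LinearMap.ker f := by
  let := Module.addCommMonoidToAddCommGroup F (M := E)
  exact Submodule.comap_map_eq f p

/-- Disconnectedness depends only on which row contains each element, and rearranging within rows
costs a scalar. So an arbitrary disconnected pair may be replaced by the readings of its correlated
tableau. -/
theorem map_phiCoordinates_disconnectedSpan (hn : 1 ≤ n) (hd : 1 ≤ d) :
    (disconnectedSpan F n d).map (phiCoordinates F n d) = disconnectedTensors F n d := by
  apply le_antisymm
  · rw [disconnectedSpan, Submodule.map_span_le]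
    rintro _ ⟨C, hC, rfl⟩
    rw [CorrelatedTableau.toTensor, phiCoordinates_tmul]
    exact Submodule.subset_span ⟨_, _, (C.not_connected_iff hn hd).1 hC, rfl⟩
  · rw [disconnectedTensors, Submodule.span_le]
    rintro _ ⟨S, T, hST, rfl⟩
    obtain ⟨c, hc⟩ := doubleDet_rearrange (R := F) S (CorrelatedTableau.ofFillings S T).rowFilling T
      (CorrelatedTableau.ofFillings S T).colFilling
      (fun k => (CorrelatedTableau.ofFillings_filling S T k).1)
      (fun k => (CorrelatedTableau.ofFillings_filling S T k).2)
    have hdisc : ¬(CorrelatedTableau.ofFillings S T).graph.Connected := by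
      rw [CorrelatedTableau.not_connected_iff _ hn hd]
      obtain ⟨P, P', h, h'⟩ := hST
      refine ⟨P, P', fun k => ?_, h'⟩
      rw [(CorrelatedTableau.ofFillings_filling S T k).1,
        (CorrelatedTableau.ofFillings_filling S T k).2]
      exact h k
    have : pairTensor F S T =
        c • phiCoordinates F n d ((CorrelatedTableau.ofFillings S T).toTensor F) := by
      rw [CorrelatedTableau.toTensor, phiCoordinates_tmul]
      funext s
      exact hc _
    rw [this]
    exact Submodule.smul_mem _ _ (Submodule.mem_map_of_mem (Submodule.subset_span ⟨_, hdisc, rfl⟩))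

/-- A subspace and `ker φ` together span everything exactly when the image of the subspace is the
whole image of `φ`. -/
theorem disconnectedSpans_iff (hn : 1 ≤ n) (hd : 1 ≤ d) :
    DisconnectedSpans F n d ↔
      ∀ S T : Fin (d * n) ≃ Fin d × Fin n, pairTensor F S T ∈ disconnectedTensors F n d := by
  rw [DisconnectedSpans, Submodule.span_union, Submodule.span_eq, Submodule.span_eq,
    ← ker_phiCoordinates, ← comap_map_eq_sup_ker, map_phiCoordinates_disconnectedSpan hn hd,
    ← top_le_iff, ← span_multiMonomial_tmul, Submodule.span_le]
  constructor
  · intro h S T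
    obtain ⟨S, hS, rfl⟩ := exists_tableauFilling_eq S
    obtain ⟨T, hT, rfl⟩ := exists_tableauFilling_eq T
    rw [← phiCoordinates_tmul]
    exact h ⟨S, T, hS, hT, rfl⟩
  · rintro h _ ⟨S, T, hS, hT, rfl⟩
    rw [SetLike.mem_coe, Submodule.mem_comap, phiCoordinates_tmul]
    exact h _ _

end Translation

/-! ### Restitution and decomposable invariants -/

section Restitution

variable {F : Type*} [Field F] {n m d : ℕ}

theorem DisconnectedPair.reindex {ι ι' D D' E E' : Type*} {S : ι ≃ D × Fin n}
    {T : ι ≃ D' × Fin n} (h : DisconnectedPair S T) (e : ι' ≃ ι) (f : D ≃ E) (f' : D' ≃ E') :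
    DisconnectedPair ((e.trans S).trans (Equiv.prodCongr f (Equiv.refl _)))
      ((e.trans T).trans (Equiv.prodCongr f' (Equiv.refl _))) := by
  obtain ⟨P, P', h, ⟨i, hi⟩, ⟨j, hj⟩⟩ := h
  refine ⟨fun i => P (f.symm i), fun i => P' (f'.symm i), fun k => ?_, ⟨f i, ?_⟩, ⟨f j, ?_⟩⟩
  · simpa using h (e k)
  · simpa using hi
  · simpa using hj

/-- Restitution: substitution of the matrices `X_{κ k}` into a multilinear function. -/
noncomputable def restitution (F : Type*) [Field F] {n m : ℕ} {ι : Type*} [Fintype ι]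
    [DecidableEq ι] (κ : ι → Fin m) :
    ((ι → Fin n × Fin n) → F) →ₗ[F] MvPolynomial (Fin m × Fin n × Fin n) F :=
  Fintype.linearCombination F fun s => ∏ k, MvPolynomial.X (κ k, s k)

theorem restitution_pairTensor {ι D D' : Type*} [Fintype ι] [DecidableEq ι] [Fintype D] [DecidableEq D] [Fintype D']
    [DecidableEq D'] (S : ι ≃ D × Fin n) (T : ι ≃ D' × Fin n) (κ : ι → Fin m) :
    restitution F κ (pairTensor F S T) = pairInvariant F S T κ := by
  rw [pairInvariant, doubleDet_expand (K := F), restitution, Fintype.linearCombination_apply]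
  rfl

/-- Polarization: the multilinear function of `κ`-multidegree extracted from a polynomial. -/
noncomputable def polarization (F : Type*) [Field F] {n m : ℕ} {ι : Type*} [Fintype ι]
    [DecidableEq ι] (κ : ι → Fin m) :
    MvPolynomial (Fin m × Fin n × Fin n) F →ₗ[F] ((ι → Fin n × Fin n) → F) :=
  LinearMap.pi fun s => polar F fun k => (κ k, s k)

/-- Matching the factors of a monomial with the variables of the polarization gives a permutation;
it must carry `κ'` to `κ` and determines the index at which `g` is read. -/
theorem polarization_restitution {ι : Type*} [Fintype ι] [DecidableEq ι] (κ κ' : ι → Fin m) (g : (ι → Fin n × Fin n) → F)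
    (s : ι → Fin n × Fin n) :
    polarization F κ (restitution F κ' g) s =
      ∑ π : Equiv.Perm ι, if ∀ k, κ' k = κ (π k) then g fun k => s (π k) else 0 := by
  rw [restitution, Fintype.linearCombination_apply, map_sum, Finset.sum_apply]
  simp only [map_smul, polarization, LinearMap.pi_apply, polar_prod_X,
    smul_eq_mul, Finset.mul_sum]
  rw [Finset.sum_comm]
  refine Finset.sum_congr rfl fun π _ => ?_
  rw [Finset.sum_eq_single fun k => s (π k)]
  · simp
  · intro s' _ hs'
    rw [if_neg, mul_zero]
    intro h
    exact hs' (funext fun k => (Prod.mk.inj (h k)).2)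
  · simp

theorem pairTensor_comp_perm {ι D D' : Type*} [Fintype ι] [Fintype D] [DecidableEq D] [Fintype D']
    [DecidableEq D'] (S : ι ≃ D × Fin n) (T : ι ≃ D' × Fin n) (π : Equiv.Perm ι)
    (s : ι → Fin n × Fin n) :
    pairTensor F S T (fun k => s (π k)) =
      pairTensor F (π.symm.trans S) (π.symm.trans T) s := by
  rw [pairTensor, doubleDet_reindex S T (π.symm.trans S) (π.symm.trans T) π.symm (Equiv.refl _)
    (Equiv.refl _) (fun _ => rfl) fun _ => rfl]
  simp only [Equiv.apply_symm_apply]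
  rfl

/-- The span of the semi-invariants attached to disconnected pairs. -/
noncomputable def disconnectedInvariants (F : Type*) [Field F] (n m d : ℕ) :
    Submodule F (MvPolynomial (Fin m × Fin n × Fin n) F) :=
  Submodule.span F {g | ∃ (S T : Fin (d * n) ≃ Fin d × Fin n) (κ : Fin (d * n) → Fin m),
    DisconnectedPair S T ∧ g = pairInvariant F S T κ}

/-- Polarization only relabels the elements of the pair by permutations, and this keeps it
disconnected. -/
theorem polarization_mem {f : MvPolynomial (Fin m × Fin n × Fin n) F}
    (hf : f ∈ disconnectedInvariants F n m d) (κ : Fin (d * n) → Fin m) :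
    polarization F κ f ∈ disconnectedTensors F n d := by
  suffices h : disconnectedInvariants F n m d ≤
      (disconnectedTensors F n d).comap (polarization F κ) from h hf
  rw [disconnectedInvariants, Submodule.span_le]
  rintro _ ⟨S, T, κ', hST, rfl⟩
  have h : polarization F κ (pairInvariant F S T κ') =
      ∑ π : Equiv.Perm (Fin (d * n)), if ∀ k, κ' k = κ (π k) then
        pairTensor F (π.symm.trans S) (π.symm.trans T) else 0 := by
    funext s
    rw [← restitution_pairTensor, polarization_restitution, Finset.sum_apply]
    refine Finset.sum_congr rfl fun π _ => ?_
    split_ifs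
    · exact pairTensor_comp_perm S T π s
    · rfl
  rw [SetLike.mem_coe, Submodule.mem_comap, h]
  refine Submodule.sum_mem _ fun π _ => ?_
  split_ifs
  · exact Submodule.subset_span ⟨_, _,
      hST.reindex π.symm (Equiv.refl _) (Equiv.refl _), rfl⟩
  · exact zero_mem _

theorem exists_mul_of_disconnectedPair [CharZero F] (hn : 1 ≤ n) {ι D D' : Type*} [Fintype ι] [Fintype D]
    [DecidableEq D] [Fintype D'] [DecidableEq D'] (S : ι ≃ D × Fin n) (T : ι ≃ D' × Fin n)
    (h : DisconnectedPair S T) (κ : ι → Fin m) :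
    ∃ p ∈ semiInvariants F n m, ∃ q ∈ semiInvariants F n m, ∃ i < Fintype.card ι,
      ∃ j < Fintype.card ι, p.IsHomogeneous i ∧ q.IsHomogeneous j ∧
        pairInvariant F S T κ = p * q := by
  classical
  obtain ⟨P, P', h, ⟨i, hi⟩, ⟨j, hj⟩⟩ := h
  refine ⟨_, pairInvariant_mem (restrictFilling S P (fun k => P (S k).1) fun _ => Iff.rfl)
      (restrictFilling T P' (fun k => P (S k).1) h) fun k => κ k, _,
    pairInvariant_mem
      (restrictFilling S (fun i => ¬P i) (fun k => ¬P (S k).1) fun _ => Iff.rfl)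
      (restrictFilling T (fun i => ¬P' i) (fun k => ¬P (S k).1) fun k => not_congr (h k))
      fun k => κ k, _, ?_, _, ?_, pairInvariant_isHomogeneous _ _ _,
    pairInvariant_isHomogeneous _ _ _, doubleDet_of_disconnected S T P P' h _⟩
  -- Each factor misses a whole row, which is nonempty as `n ≥ 1`; so both degrees drop strictly.
  · exact Fintype.card_subtype_lt (x := S.symm (j, ⟨0, hn⟩)) (by simpa using hj)
  · exact Fintype.card_subtype_lt (x := S.symm (i, ⟨0, hn⟩)) (by simpa using hi)

/-- Disconnected tableaux split off invariants of smaller degree. -/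
theorem generatedInDegreeLE_of_disconnectedSpans [CharZero F] {b : ℕ} (hn : 1 ≤ n)
    (h : ∀ d > b, DisconnectedSpans F n d) : GeneratedInDegreeLE F n m (b * n) := by
  have key : ∀ N, ∀ f ∈ semiInvariants F n m, f.IsHomogeneous N →
      f ∈ Algebra.adjoin F {f | f ∈ semiInvariants F n m ∧ f.totalDegree ≤ b * n} := by
    intro N
    induction N using Nat.strong_induction_on with
    | _ N ih =>
      intro f hf hN
      by_cases hNb : N ≤ b * n
      · exact Algebra.subset_adjoin ⟨hf, hN.totalDegree_le.trans hNb⟩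
      by_cases hf0 : f = 0
      · rw [hf0]
        exact zero_mem _
      -- The degree of a nonzero homogeneous semi-invariant is a multiple of `n`, so exceeding `b *
      -- n` means `b < d`.
      obtain ⟨d, rfl, -⟩ := genericLeft_eq hn hf hN hf0
      have hd : b < d := lt_of_mul_lt_mul_right (not_le.1 hNb) (Nat.zero_le n)
      have hspan := (disconnectedSpans_iff hn (by omega)).1 (h d hd)
      rw [← Subalgebra.mem_toSubmodule]
      suffices hle : pairSpan F n m d ≤ Subalgebra.toSubmodule (Algebra.adjoin F
          {f | f ∈ semiInvariants F n m ∧ f.totalDegree ≤ b * n}) from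
        hle (mem_pairSpan hn hf hN)
      rw [pairSpan, Submodule.span_le]
      rintro _ ⟨S, T, κ, rfl⟩
      suffices hle : disconnectedTensors F n d ≤ (Subalgebra.toSubmodule (Algebra.adjoin F
          {f | f ∈ semiInvariants F n m ∧ f.totalDegree ≤ b * n})).comap (restitution F κ) by
        rw [← restitution_pairTensor]
        exact hle (hspan S T)
      rw [disconnectedTensors, Submodule.span_le]
      rintro _ ⟨S', T', hST, rfl⟩
      rw [SetLike.mem_coe, Submodule.mem_comap, restitution_pairTensor,
        Subalgebra.mem_toSubmodule]
      obtain ⟨p, hp, q, hq, i, hi, j, hj, hpi, hqj, hpq⟩ :=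
        exists_mul_of_disconnectedPair (F := F) hn S' T' hST κ
      rw [Fintype.card_fin] at hi hj
      rw [hpq]
      exact mul_mem (ih i hi p hp hpi) (ih j hj q hq hqj)
  refine le_antisymm (Algebra.adjoin_le fun f hf => hf.1) fun f hf => ?_
  rw [← MvPolynomial.sum_homogeneousComponent f]
  exact sum_mem fun i _ => key i _ (homogeneousComponent_mem_semiInvariants hf i)
    (MvPolynomial.homogeneousComponent_isHomogeneous i f)

/-- The decomposable invariants of degree `N`. -/
noncomputable def decomposables (F : Type*) [Field F] (n m N : ℕ) :
    Submodule F (MvPolynomial (Fin m × Fin n × Fin n) F) :=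
  Submodule.span F {g | ∃ p ∈ semiInvariants F n m, ∃ q ∈ semiInvariants F n m, ∃ i j,
    0 < i ∧ 0 < j ∧ i + j = N ∧ p.IsHomogeneous i ∧ q.IsHomogeneous j ∧ g = p * q}

theorem homogeneousComponent_mem_decomposables {D : ℕ} (h : GeneratedInDegreeLE F n m D)
    {f : MvPolynomial (Fin m × Fin n × Fin n) F} (hf : f ∈ semiInvariants F n m) {N : ℕ}
    (hN : D < N) : MvPolynomial.homogeneousComponent N f ∈ decomposables F n m N := by
  rw [← h] at hf
  -- Membership is carried along the induction because the components of both factors must be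
  -- semi-invariants in the product case.
  suffices H : f ∈ semiInvariants F n m ∧ ∀ N, D < N →
      MvPolynomial.homogeneousComponent N f ∈ decomposables F n m N from H.2 N hN
  induction hf using Algebra.adjoin_induction with
  | mem f hf =>
    refine ⟨hf.1, fun N hN => ?_⟩
    rw [MvPolynomial.homogeneousComponent_eq_zero N f (hf.2.trans_lt hN)]
    exact zero_mem _
  | algebraMap c =>
    refine ⟨algebraMap_mem _ c, fun N hN => ?_⟩
    rw [MvPolynomial.algebraMap_eq, MvPolynomial.homogeneousComponent_eq_zero N _
      (by rw [MvPolynomial.totalDegree_C]; omega)]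
    exact zero_mem _
  | add f g _ _ hf hg =>
    refine ⟨add_mem hf.1 hg.1, fun N hN => ?_⟩
    rw [map_add]
    exact add_mem (hf.2 N hN) (hg.2 N hN)
  | mul f g _ _ hf hg =>
    refine ⟨mul_mem hf.1 hg.1, fun N hN => ?_⟩
    rw [← MvPolynomial.sum_homogeneousComponent f, ← MvPolynomial.sum_homogeneousComponent g,
      Finset.sum_mul_sum, map_sum]
    refine Submodule.sum_mem _ fun i _ => ?_
    rw [map_sum]
    refine Submodule.sum_mem _ fun j _ => ?_
    have hi := MvPolynomial.homogeneousComponent_isHomogeneous i f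
    have hj := MvPolynomial.homogeneousComponent_isHomogeneous j g
    rw [MvPolynomial.homogeneousComponent_of_mem (hi.mul hj)]
    split_ifs with hij
    swap
    · exact zero_mem _
    -- A factor of degree zero is a scalar, which leaves a component of the other factor in the same
    -- degree.
    rcases Nat.eq_zero_or_pos i with rfl | hi0
    · rw [MvPolynomial.homogeneousComponent_zero, ← MvPolynomial.smul_eq_C_mul]
      obtain rfl : N = j := by omega
      exact Submodule.smul_mem _ _ (hg.2 N hN)
    rcases Nat.eq_zero_or_pos j with rfl | hj0
    · rw [MvPolynomial.homogeneousComponent_zero, mul_comm, ← MvPolynomial.smul_eq_C_mul]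
      obtain rfl : N = i := by omega
      exact Submodule.smul_mem _ _ (hf.2 N hN)
    exact Submodule.subset_span ⟨_, homogeneousComponent_mem_semiInvariants hf.1 i, _,
      homogeneousComponent_mem_semiInvariants hg.1 j, i, j, hi0, hj0, hij.symm, hi, hj, rfl⟩

theorem pairInvariant_mul_mem {d' : ℕ} (hd : 0 < d) (hd' : 0 < d')
    (S T : Fin (d * n) ≃ Fin d × Fin n) (S' T' : Fin (d' * n) ≃ Fin d' × Fin n)
    (κ : Fin (d * n) → Fin m) (κ' : Fin (d' * n) → Fin m) :
    pairInvariant F S T κ * pairInvariant F S' T' κ' ∈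
      disconnectedInvariants F n m (d + d') := by
  have : Nonempty (Fin d) := ⟨⟨0, hd⟩⟩
  have : Nonempty (Fin d') := ⟨⟨0, hd'⟩⟩
  let e : Fin ((d + d') * n) ≃ Fin (d * n) ⊕ Fin (d' * n) :=
    (finCongr (add_mul d d' n)).trans finSumFinEquiv.symm
  refine Submodule.subset_span ⟨_, _, fun k => Sum.elim κ κ' (e k),
    (disconnectedPair_sumFilling S T S' T').reindex e finSumFinEquiv finSumFinEquiv, ?_⟩
  refine ((doubleDet_sumFilling S T S' T' fun k =>
    genericMatrix F n m (Sum.elim κ κ' k)).symm).trans ?_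
  exact doubleDet_reindex _ _ _ _ e finSumFinEquiv.symm finSumFinEquiv.symm (fun k => by simp)
    (fun k => by simp) _

/-- By the first fundamental theorem both factors are combinations of pair invariants, and a product
of two of these belongs to a disjoint union of fillings. -/
theorem decomposables_le [CharZero F] (hn : 1 ≤ n) :
    decomposables F n m (d * n) ≤ disconnectedInvariants F n m d := by
  rw [decomposables, Submodule.span_le]
  rintro _ ⟨p, hp, q, hq, i, j, hi, hj, hij, hpi, hqj, rfl⟩
  by_cases hp0 : p = 0
  · rw [hp0, zero_mul]
    exact zero_mem _
  by_cases hq0 : q = 0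
  · rw [hq0, mul_zero]
    exact zero_mem _
  obtain ⟨d₁, rfl, -⟩ := genericLeft_eq hn hp hpi hp0
  obtain ⟨d₂, rfl, -⟩ := genericLeft_eq hn hq hqj hq0
  rw [← add_mul] at hij
  obtain rfl := Nat.eq_of_mul_eq_mul_right hn hij
  have h := Submodule.mul_mem_mul (mem_pairSpan hn hp hpi) (mem_pairSpan hn hq hqj)
  rw [pairSpan, pairSpan, Submodule.span_mul_span] at h
  refine Submodule.span_le.2 ?_ h
  rintro _ ⟨_, ⟨S, T, κ, rfl⟩, _, ⟨S', T', κ', rfl⟩, rfl⟩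
  exact pairInvariant_mul_mem (Nat.pos_of_mul_pos_right hi) (Nat.pos_of_mul_pos_right hj) _ _ _ _ _ _

end Restitution

/-! ### Reconstruction of a multilinear function from its restitutions -/

section Reconstruction

variable {F : Type*} [Field F] {n m : ℕ} {ι X : Type*} [Fintype ι] [DecidableEq ι]

/-- The matrix of the operator that polarizes all restitutions of a multilinear function. -/
def gramMatrix (ι X : Type*) [Fintype ι] [DecidableEq ι] [DecidableEq X] (m : ℕ) :
    Matrix (ι → X) (ι → X) ℤ :=
  Matrix.of fun s s' => ∑ κ : ι → Fin m, ∑ π : Equiv.Perm ι,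
    if (∀ k, κ k = κ (π k)) ∧ (fun k => s (π k)) = s' then 1 else 0

theorem gramMatrix_mulVec [Fintype X] [DecidableEq X] {R : Type*} [CommRing R] (v : (ι → X) → R) (s : ι → X) :
    ((gramMatrix ι X m).map (Int.cast : ℤ → R)).mulVec v s =
      ∑ κ : ι → Fin m, ∑ π : Equiv.Perm ι,
        if ∀ k, κ k = κ (π k) then v fun k => s (π k) else 0 := by
  simp only [Matrix.mulVec, dotProduct, Matrix.map_apply, gramMatrix, Matrix.of_apply,
    Int.cast_sum, Finset.sum_mul]
  rw [Finset.sum_comm]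
  refine Finset.sum_congr rfl fun κ _ => ?_
  rw [Finset.sum_comm]
  refine Finset.sum_congr rfl fun π _ => ?_
  simp [ite_and]

/-- The sum of the translates of `v` by the stabilizer of `κ`. -/
def stabilizerSum (κ : ι → Fin m) (v : (ι → X) → ℤ) (s : ι → X) : ℤ :=
  ∑ π : Equiv.Perm ι, if ∀ k, κ k = κ (π k) then v fun k => s (π k) else 0

theorem stabilizerSum_comp (κ : ι → Fin m) (v : (ι → X) → ℤ) (s : ι → X) (ρ : Equiv.Perm ι)
    (hρ : ∀ k, κ k = κ (ρ k)) :
    stabilizerSum κ v (fun k => s (ρ k)) = stabilizerSum κ v s := by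
  refine Fintype.sum_equiv (Equiv.mulLeft ρ) _ _ fun π => ?_
  refine if_congr (forall_congr' fun k => ?_) rfl rfl
  rw [Equiv.coe_mulLeft, Equiv.Perm.mul_apply, ← hρ]

/-- Summing over a group is, up to the group order, the orthogonal projection onto its invariants;
hence `stabilizerSum κ` is positive semidefinite. -/
theorem sum_stabilizerSum_sq [Fintype X] (κ : ι → Fin m) (v : (ι → X) → ℤ) :
    ∑ s, stabilizerSum κ v s ^ 2 =
      (∑ π : Equiv.Perm ι, if ∀ k, κ k = κ (π k) then 1 else 0) *
        ∑ s, v s * stabilizerSum κ v s := by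
  have h : ∀ s, stabilizerSum κ v s ^ 2 = ∑ π : Equiv.Perm ι, if ∀ k, κ k = κ (π k) then
      v (fun k => s (π k)) * stabilizerSum κ v (fun k => s (π k)) else 0 := by
    intro s
    rw [sq]
    nth_rewrite 1 [stabilizerSum]
    rw [Finset.sum_mul]
    refine Finset.sum_congr rfl fun π _ => ?_
    split_ifs with hπ
    · rw [stabilizerSum_comp κ v s π hπ]
    · rw [zero_mul]
  simp only [h]
  rw [Finset.sum_comm, Finset.sum_mul]
  refine Finset.sum_congr rfl fun π _ => ?_
  split_ifs
  · rw [one_mul]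
    exact (π.symm.arrowCongr (Equiv.refl X)).sum_comp fun s => v s * stabilizerSum κ v s
  · simp

theorem card_stabilizer_pos (κ : ι → Fin m) :
    (0 : ℤ) < ∑ π : Equiv.Perm ι, if ∀ k, κ k = κ (π k) then 1 else 0 := by
  refine Finset.sum_pos' (fun π _ => ?_) ⟨1, Finset.mem_univ _, by simp⟩
  split_ifs <;> norm_num

theorem sum_mul_stabilizerSum_nonneg [Fintype X] (κ : ι → Fin m) (v : (ι → X) → ℤ) :
    0 ≤ ∑ s, v s * stabilizerSum κ v s := by
  refine nonneg_of_mul_nonneg_right ?_ (card_stabilizer_pos κ)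
  rw [← sum_stabilizerSum_sq]
  exact Finset.sum_nonneg fun s _ => sq_nonneg _

/-- The matrix is a sum over `κ` of positive semidefinite ones, so a kernel vector `v` is killed by
every `stabilizerSum κ`. Working over the integers makes this order argument available; nonvanishing
of the determinant then passes to any field of characteristic zero. -/
theorem det_gramMatrix_ne_zero [Fintype X] [DecidableEq X] (h : Fintype.card X ≤ m) : (gramMatrix ι X m).det ≠ 0 := by
  intro h0
  obtain ⟨v, hv0, hv⟩ := Matrix.exists_mulVec_eq_zero_iff.2 h0
  apply hv0
  have hv' : ∀ s, ∑ κ : ι → Fin m, stabilizerSum κ v s = 0 := by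
    intro s
    have := gramMatrix_mulVec (m := m) v s
    rw [show (gramMatrix ι X m).map (Int.cast : ℤ → ℤ) = gramMatrix ι X m from by ext; simp,
      hv] at this
    exact this.symm
  have hsum : ∑ κ : ι → Fin m, ∑ s, v s * stabilizerSum κ v s = 0 := by
    rw [Finset.sum_comm]
    simp [← Finset.mul_sum, hv']
  obtain ⟨j⟩ : Nonempty (X ↪ Fin m) :=
    Function.Embedding.nonempty_of_card_le (by rwa [Fintype.card_fin])
  funext s
  -- For `κ = j ∘ s` with `j` injective, the stabilizer of `κ` also fixes `s`. So `stabilizerSum κ v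
  -- s` is a positive multiple of `v s`.
  have h1 := (Finset.sum_eq_zero_iff_of_nonneg fun κ _ =>
    sum_mul_stabilizerSum_nonneg κ v).1 hsum (fun k => j (s k)) (Finset.mem_univ _)
  have h2 := sum_stabilizerSum_sq (fun k => j (s k)) v
  rw [h1, mul_zero] at h2
  have h3 := (Finset.sum_eq_zero_iff_of_nonneg fun s _ => sq_nonneg _).1 h2 s (Finset.mem_univ _)
  have h4 : stabilizerSum (fun k => j (s k)) v s =
      (∑ π : Equiv.Perm ι, if ∀ k, j (s k) = j (s (π k)) then 1 else 0) * v s := by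
    rw [stabilizerSum, Finset.sum_mul]
    refine Finset.sum_congr rfl fun π _ => ?_
    split_ifs with hπ
    · rw [one_mul]
      congr 1
      exact funext fun k => (j.injective (hπ k)).symm
    · rw [zero_mul]
  rw [pow_eq_zero_iff two_ne_zero, h4] at h3
  exact (mul_eq_zero.1 h3).resolve_left (card_stabilizer_pos _).ne'

theorem eq_zero_of_sum_polarization_restitution [CharZero F] (h : n ^ 2 ≤ m)
    (g : (ι → Fin n × Fin n) → F)
    (hg : ∑ κ : ι → Fin m, polarization F κ (restitution F κ g) = 0) : g = 0 := by
  have hdet : ((gramMatrix ι (Fin n × Fin n) m).map (Int.cast : ℤ → F)).det ≠ 0 := by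
    have e := (Int.castRingHom F).map_det (gramMatrix ι (Fin n × Fin n) m)
    have e' : ((gramMatrix ι (Fin n × Fin n) m).map (Int.cast : ℤ → F)).det =
        ((gramMatrix ι (Fin n × Fin n) m).det : F) := e.symm
    rw [e', Int.cast_ne_zero]
    refine det_gramMatrix_ne_zero ?_
    rwa [Fintype.card_prod, Fintype.card_fin, ← sq]
  refine Matrix.eq_zero_of_mulVec_eq_zero hdet (funext fun s => ?_)
  rw [gramMatrix_mulVec]
  simp only [← polarization_restitution]
  simpa using congrFun hg s

/-- Generation in low degree makes all tableaux combinations of disconnected ones. -/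
theorem disconnectedSpans_of_generatedInDegreeLE [CharZero F] {b d : ℕ} (hn : 1 ≤ n)
    (hm : n ^ 2 ≤ m) (h : GeneratedInDegreeLE F n m (b * n)) (hd : b < d) :
    DisconnectedSpans F n d := by
  rw [disconnectedSpans_iff hn (by omega)]
  let W : Submodule F ((Fin (d * n) → Fin n × Fin n) → F) :=
    Submodule.span F {g | ∃ S T : Fin (d * n) ≃ Fin d × Fin n, g = pairTensor F S T}
  -- All `κ` are summed because no single one need determine a multilinear function.
  let L : ((Fin (d * n) → Fin n × Fin n) → F) →ₗ[F] ((Fin (d * n) → Fin n × Fin n) → F) :=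
    ∑ κ : Fin (d * n) → Fin m, polarization F κ ∘ₗ restitution F κ
  have hL : Function.Injective L := by
    rw [injective_iff_map_eq_zero]
    intro g hg
    refine eq_zero_of_sum_polarization_restitution hm g ?_
    rw [← hg]
    simp [L]
  have hle : disconnectedTensors F n d ≤ W := by
    refine Submodule.span_mono ?_
    rintro _ ⟨S, T, -, rfl⟩
    exact ⟨S, T, rfl⟩
  have hmap : W.map L ≤ disconnectedTensors F n d := by
    rw [Submodule.map_span_le]
    rintro _ ⟨S, T, rfl⟩
    simp only [L, LinearMap.sum_apply, LinearMap.comp_apply, restitution_pairTensor]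
    refine Submodule.sum_mem _ fun κ _ => polarization_mem (decomposables_le hn ?_) κ
    have hhom := pairInvariant_isHomogeneous (F := F) S T κ
    rw [Fintype.card_fin] at hhom
    rw [← MvPolynomial.homogeneousComponent_eq_self hhom]
    exact homogeneousComponent_mem_decomposables h (pairInvariant_mem S T κ)
      (Nat.mul_lt_mul_of_pos_right hd hn)
  -- `L` is injective on `W` with image inside the disconnected part, which lies in `W`; finite
  -- dimension forces equality.
  have hW : disconnectedTensors F n d = W := by
    refine Submodule.eq_of_le_of_finrank_le hle ?_
    rw [(Submodule.equivMapOfInjective L hL W).finrank_eq]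
    exact Submodule.finrank_mono hmap
  intro S T
  rw [hW]
  exact Submodule.subset_span ⟨S, T, rfl⟩

end Reconstruction

theorem mainTheorem5 {F : Type*} [Field F] [CharZero F] (n m b : ℕ) (hn : 1 ≤ n) :
    ((∀ d > b, DisconnectedSpans F n d) → GeneratedInDegreeLE F n m (b * n)) ∧
    (n ^ 2 ≤ m →
      (GeneratedInDegreeLE F n m (b * n) ↔ ∀ d > b, DisconnectedSpans F n d)) :=
  ⟨generatedInDegreeLE_of_disconnectedSpans hn, fun hm =>
    ⟨fun h _ hd => disconnectedSpans_of_generatedInDegreeLE hn hm h hd,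
      generatedInDegreeLE_of_disconnectedSpans hn⟩⟩
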